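/- **Theorem 3.4 (Main Theorem).** Let $X$ be a CAT(0) space (a geodesic metric space whose geodesic triangles are no fatter than their Euclidean comparison triangles; completeness is not assumed). Let $I\subset\mathbb R$ be an interval and let $\gamma\colon I\to X$ be a $(K,L)$-quasi-geodesic with $K\ge 1$, $L\ge 0$, that is, $\frac{|s-t|}{K}-L\le d(\gamma(s),\gamma(t))\le K|s-t|+L$ for all $s,t\in I$ (no continuity is assumed). Write $\gamma$ also for the image $\gamma(I)$, and for $x\in X$ let $\pi_\gamma(x)$ be the set of points of $\gamma$ nearest to $x$. Consider the following conditions. 1. $\gamma$ is $(b,c)$-contracting for some $0<b\le 1$ and $c>0$: for all $x,y\in X$ with $d(x,y)<b\,d(x,\gamma)$ and all $p\in\pi_\gamma(x)$, $q\in\pi_\gamma(y)$, one has $d(p,q)<c$. 2. $\gamma$ is strongly contracting: it is $(1,c)$-contracting for some $c>0$. 3. $\gamma$ is Morse: for all $K',L'$ there is $M$ such that every $(K',L')$-quasi-geodesic $\sigma\colon[a,b]\to X$ with endpoints $\sigma(a),\sigma(b)$ on $\gamma$ lies in the $M$-neighbourhood of $\gamma$, that is, $d(\sigma(t),\gamma)\le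 M$ for all $t\in[a,b]$. 4. In every asymptotic cone $X_\omega=\mathrm{Cone}_\omega(X,(x_n),(s_n))$ (with $\omega$ any non-principal ultrafilter on $\mathbb N$, any observation points $x_n\in X$, and any scaling constants $s_n>0$ with $\lim_\omega s_n=\infty$), any two distinct points $u,v$ of the ultralimit $\gamma_\omega$ (the set of points represented by sequences $(z_n)$ with $z_n\in\gamma$ for $\omega$-almost all $n$) are separated by a cutpoint: there is $p\in X_\omega\setminus\{u,v\}$ such that no path in $X_\omega\setminus\{p\}$ joins $u$ to $v$. If every point of $X$ has a nearest point on $\gamma$ (as is presupposed in (1) and (2), and as holds when $\gamma$ is continuous and $I$ is non-empty and closed), then (1), (2), (3) and (4) are equivalent. The equivalence of (3) and (4) holds without this proviso. Moreover, if $I=\mathbb R$, then any of these conditions (with the same proviso for (1) and (2)) implies that $\gamma$ has at least quadratic divergence: for every $\delta\in(0,1]$ there is $a>0$ such that, for all sufficiently large $r\in\mathbb N$, every path in $X$ from $\gamma(-r)$ to $\gamma(r)$ that avoids the open ball of radius $\delta r$ about $\gamma(0)$ has length at least $a r^2$. -/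

import Mathlib

open Set Filter Topology

noncomputable section

/-! ### CAT(0) spaces -/

/-- `c`, restricted to `[0, dist x y]`, is a geodesic from `x` to `y` parametrized by arc length. -/
structure IsGeodesicFromTo {X : Type*} [MetricSpace X] (c : ℝ → X) (x y : X) : Prop where
  start : c 0 = x
  finish : c (dist x y) = y
  isometry : ∀ s ∈ Icc 0 (dist x y), ∀ t ∈ Icc 0 (dist x y), dist (c s) (c t) = |s - t|

/-- A CAT(0) space: a geodesic metric space whose geodesic triangles are no fatter than their
comparison triangles `p' q' r'` in the Euclidean plane. Two sides of a triangle always have a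
common vertex, called `p` here; `x'` and `y'` are the comparison points of the points `c s` and
`c' t` of these sides. Completeness is not part of the notion. -/
structure IsCAT0 (X : Type*) [MetricSpace X] : Prop where
  exists_geodesic : ∀ x y : X, ∃ c : ℝ → X, IsGeodesicFromTo c x y
  comparison : ∀ (p q r : X) (c c' : ℝ → X),
    IsGeodesicFromTo c p q → IsGeodesicFromTo c' p r →
    ∀ p' q' r' : EuclideanSpace ℝ (Fin 2),
      dist p' q' = dist p q → dist p' r' = dist p r → dist q' r' = dist q r →
      ∀ x' ∈ segment ℝ p' q', ∀ y' ∈ segment ℝ p' r',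
      ∀ s t : ℝ, dist p' x' = s → dist p' y' = t → dist (c s) (c' t) ≤ dist x' y'

/-! ### Quasi-geodesics, the Morse property, contraction -/

/-- `γ : I → X` is a `(K, L)`-quasi-geodesic defined on the interval `I` (bounded or not, with or
without its endpoints; no continuity is required). Only the values of `γ` on `I` matter. -/
structure IsQuasiGeodesic {X : Type*} [MetricSpace X] (K L : ℝ) (I : Set ℝ) (γ : ℝ → X) :
    Prop where
  one_le : 1 ≤ K
  nonneg : 0 ≤ L
  interval : I.OrdConnected
  lower : ∀ s ∈ I, ∀ t ∈ I, |s - t| / K - L ≤ dist (γ s) (γ t)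
  upper : ∀ s ∈ I, ∀ t ∈ I, dist (γ s) (γ t) ≤ K * |s - t| + L

/-- The Morse property of a subset `S`, used for the image of a quasi-geodesic: every
`(K, L)`-quasi-geodesic with endpoints on `S` stays within a distance of `S` that is bounded in
terms of `K` and `L`. -/
def IsMorse {X : Type*} [MetricSpace X] (S : Set X) : Prop :=
  ∀ K L : ℝ, ∃ M : ℝ, ∀ (a b : ℝ) (σ : ℝ → X), a ≤ b → IsQuasiGeodesic K L (Icc a b) σ →
    σ a ∈ S → σ b ∈ S → ∀ t ∈ Icc a b, Metric.infDist (σ t) S ≤ M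

/-- The nearest point projection of `x` to `S`: the set of points of `S` nearest to `x`. -/
def nearestPoints {X : Type*} [MetricSpace X] (S : Set X) (x : X) : Set X :=
  {p | p ∈ S ∧ dist x p = Metric.infDist x S}

/-- `(b, c)`-contraction: `d(x, y) < b d(x, π(x))` implies `d(π(x), π(y)) < c`, for all choices of
nearest points. -/
def IsContracting {X : Type*} [MetricSpace X] (b c : ℝ) (S : Set X) : Prop :=
  ∀ x y : X, dist x y < b * Metric.infDist x S →
    ∀ p ∈ nearestPoints S x, ∀ q ∈ nearestPoints S y, dist p q < c

/-! ### Asymptotic cones -/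

/-- The data defining an asymptotic cone: a non-principal ultrafilter, observation points, and
scaling constants whose ultralimit is infinite. -/
structure ConeData (X : Type*) where
  ultra : Ultrafilter ℕ
  nonprincipal : ∀ n : ℕ, {n} ∉ ultra
  base : ℕ → X
  scale : ℕ → ℝ
  scale_pos : ∀ n, 0 < scale n
  scale_tendsto : Tendsto scale (ultra : Filter ℕ) atTop

/-- The sequences `y` such that `dist (x n) (y n) / s n` has a finite ultralimit. -/
def ConeSeq {X : Type*} [MetricSpace X] (C : ConeData X) : Type _ :=
  {y : ℕ → X // ∃ B : ℝ, ∀ᶠ n in (C.ultra : Filter ℕ), dist (C.base n) (y n) / C.scale n ≤ B}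

namespace ConeSeq

variable {X : Type*} [MetricSpace X] {C : ConeData X}

/-- The ultralimit of the rescaled distances of two sequences. -/
def ultraDist (y z : ConeSeq C) : ℝ :=
  limUnder (C.ultra : Filter ℕ) fun n => dist (y.1 n) (z.1 n) / C.scale n

theorem tendsto_ultraDist (y z : ConeSeq C) :
    Tendsto (fun n => dist (y.1 n) (z.1 n) / C.scale n) (C.ultra : Filter ℕ)
      (𝓝 (ultraDist y z)) := by
  obtain ⟨B₁, h₁⟩ := y.2
  obtain ⟨B₂, h₂⟩ := z.2
  have hmem : ∀ᶠ n in (C.ultra : Filter ℕ),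
      dist (y.1 n) (z.1 n) / C.scale n ∈ Icc (0 : ℝ) (B₁ + B₂) := by
    filter_upwards [h₁, h₂] with n hn₁ hn₂
    have hs := C.scale_pos n
    refine ⟨by positivity, ?_⟩
    have h := div_le_div_of_nonneg_right (dist_triangle_left (y.1 n) (z.1 n) (C.base n)) hs.le
    rw [add_div] at h
    linarith
  obtain ⟨l, -, hl⟩ := (isCompact_Icc (a := (0 : ℝ)) (b := B₁ + B₂)).ultrafilter_le_nhds
    (C.ultra.map fun n => dist (y.1 n) (z.1 n) / C.scale n) (le_principal_iff.2 hmem)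
  exact tendsto_nhds_limUnder ⟨l, hl⟩

instance : PseudoMetricSpace (ConeSeq C) where
  dist := ultraDist
  dist_self y := by
    refine tendsto_nhds_unique (tendsto_ultraDist y y) ?_
    simp
  dist_comm y z := by
    refine tendsto_nhds_unique (tendsto_ultraDist y z) ?_
    simpa only [dist_comm] using tendsto_ultraDist z y
  dist_triangle y z w := by
    refine le_of_tendsto_of_tendsto' (tendsto_ultraDist y w)
      ((tendsto_ultraDist y z).add (tendsto_ultraDist z w)) fun n => ?_
    rw [← add_div]
    exact div_le_div_of_nonneg_right (dist_triangle _ _ _) (C.scale_pos n).le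

end ConeSeq

/-- The asymptotic cone: sequences at finite rescaled distance from the observation points, two
sequences being identified when their rescaled distance has ultralimit `0`. -/
abbrev AsymptoticCone {X : Type*} [MetricSpace X] (C : ConeData X) : Type _ :=
  SeparationQuotient (ConeSeq C)

/-- The ultralimit of `S` in an asymptotic cone: the points represented by a sequence that lies
in `S` for almost all indices. -/
def ultralimit {X : Type*} [MetricSpace X] (C : ConeData X) (S : Set X) :
    Set (AsymptoticCone C) :=
  {w | ∃ z : ConeSeq C, (∀ᶠ n in (C.ultra : Filter ℕ), z.1 n ∈ S) ∧ SeparationQuotient.mk z = w}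

/-- `u` and `v` are separated by a cutpoint: there is a point `p` different from both whose
complement contains no path from `u` to `v`. -/
def SeparatedByCutpoint {Y : Type*} [TopologicalSpace Y] (u v : Y) : Prop :=
  ∃ p : Y, p ≠ u ∧ p ≠ v ∧ ¬ JoinedIn {p}ᶜ u v

/-- In every asymptotic cone, any two distinct points in the ultralimit of `S` are separated by a
cutpoint. -/
def UltralimitsSeparated {X : Type*} [MetricSpace X] (S : Set X) : Prop :=
  ∀ C : ConeData X, ∀ u ∈ ultralimit C S, ∀ v ∈ ultralimit C S, u ≠ v → SeparatedByCutpoint u v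

/-! ### Divergence -/

open scoped ENNReal in
/-- The infimal length of a path from `γ (-r)` to `γ r` that avoids the open ball of radius `ρ`
about `γ 0` (infinite if there is no such rectifiable path). -/
def detourLength {X : Type*} [MetricSpace X] (γ : ℝ → X) (r ρ : ℝ) : ℝ≥0∞ :=
  ⨅ (α : Path (γ (-r)) (γ r)) (_ : ∀ t, α t ∉ Metric.ball (γ 0) ρ), eVariationOn α univ

/-- The divergence along the bi-infinite path `γ` is at least quadratic. The case `δ = 1` is the
detour function of a path that avoids the ball of radius `r` about `γ 0`; the smaller balls are
included because for a quasi-geodesic the points `γ (-r)` and `γ r` may lie inside the ball of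
radius `r`, so that `δ = 1` alone could hold for the empty reason that there is no detour. -/
def HasAtLeastQuadraticDivergence {X : Type*} [MetricSpace X] (γ : ℝ → X) : Prop :=
  ∀ δ : ℝ, 0 < δ → δ ≤ 1 → ∃ a : ℝ, 0 < a ∧
    ∀ᶠ r : ℕ in atTop, ENNReal.ofReal (a * (r : ℝ) ^ 2) ≤ detourLength γ r (δ * r)

end

/-!
The equivalences are proved by the cycle Morse ⟹ coarsely contracting ⟹ (ultralimits separated,
strongly contracting), ultralimits separated ⟹ Morse, and contracting ⟹ Morse. Coarse contraction
(`IsCoarselyContracting`) is strong contraction for points of `S = γ(I)` that are nearest up to an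
error `1`; such points exist without any properness or closedness, which is why the proviso on
nearest points enters only in "contracting ⟹ Morse".

*Morse ⟹ coarsely contracting* is where the CAT(0) condition matters. Let `p` be an almost nearest
point of `S` to `x`, and let `y` be in `S`. If the geodesic `[x, y]` misses a large ball about `p`,
then going from `p` towards `x`, crossing over to `[x, y]` and following it to `y` is a
quasi-geodesic with uniform constants (convexity of the metric along geodesics issuing from `x`)
that leaves a large neighbourhood of `S`. So `[x, y]` passes close to `p`
(`IsMorse.exists_slim`). Now let `p` and `q` be projections of `x` and `y` with
`d(x, y) < d(x, S)`. Both `[x, q]` passes close to `p` and `[y, p]` passes close to `q`, and the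
inequality of Bruhat and Tits for `y` and the geodesic `[x, q]` bounds `d(p, q)`
(`IsMorse.exists_isCoarselyContracting`).

*Coarsely contracting ⟹ ultralimits separated, and quadratic divergence*: both rest on
`IsCoarselyContracting.exists_crossings`. A path that crosses a piece of `γ` of length `ρ` in
projection while staying at distance about `H` or more from it has to make of the order of `ρ` moves
of length `H`, because shorter moves displace the projection by a bounded amount only. With `ρ` and
`H` proportional to `r` this gives the quadratic divergence; a path in the cone that avoids the
midpoint of a piece of the ultralimit would give such a crossing with a bounded number of moves.

*Ultralimits separated ⟹ Morse*: rescale excursions of quasi-geodesics by their height. In the cone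
they contain an arc with distinct endpoints on the ultralimit of `γ` and otherwise disjoint from it
(`exists_first_mem_ultralimit`), while the ultralimit itself is path connected; so no cutpoint
separates the endpoints.

*Contracting ⟹ Morse* is the usual argument that the projection to `S` of a quasi-geodesic far from
`S` advances too slowly (`IsContracting.isMorse`).
-/

/-! ### Comparison triangles and the inequality of Bruhat and Tits -/

section

/-- Three nonnegative numbers satisfying the triangle inequalities are the side lengths of a
triangle in the Euclidean plane. -/
theorem exists_comparison_triangle {A B C : ℝ} (hA : 0 < A) (hB : 0 ≤ B) (hC : 0 ≤ C)
    (h₁ : A ≤ B + C) (h₂ : B ≤ A + C) (h₃ : C ≤ A + B) :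
    ∃ p q r : EuclideanSpace ℝ (Fin 2), dist p q = A ∧ dist p r = B ∧ dist q r = C := by
  set u : ℝ := (A ^ 2 + B ^ 2 - C ^ 2) / (2 * A) with hu
  have hu' : 2 * A * u = A ^ 2 + B ^ 2 - C ^ 2 := by rw [hu]; field_simp
  have huB : u ^ 2 ≤ B ^ 2 := by
    apply sq_le_sq'
    · nlinarith [mul_nonneg (sub_nonneg.2 h₃) (add_nonneg (add_nonneg hA.le hB) hC)]
    · nlinarith [mul_nonneg (sub_nonneg.2 h₁) (sub_nonneg.2 h₂)]
  have hv := Real.sq_sqrt (sub_nonneg.2 huB)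
  refine ⟨!₂[0, 0], !₂[A, 0], !₂[u, Real.sqrt (B ^ 2 - u ^ 2)], ?_, ?_, ?_⟩ <;>
    rw [EuclideanSpace.dist_eq, Fin.sum_univ_two] <;>
    simp only [Real.dist_eq, sq_abs, Matrix.cons_val_zero, Matrix.cons_val_one,
      Matrix.cons_val_fin_one] <;>
    rw [Real.sqrt_eq_iff_mul_self_eq (by positivity) (by positivity)] <;> nlinarith

/-- Stewart's identity in the Euclidean plane. -/
theorem dist_sq_lineMap (p q r : EuclideanSpace ℝ (Fin 2)) (s : ℝ) :
    dist (AffineMap.lineMap q r s) p ^ 2 =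
      (1 - s) * dist p q ^ 2 + s * dist p r ^ 2 - s * (1 - s) * dist q r ^ 2 := by
  simp only [EuclideanSpace.dist_eq, Fin.sum_univ_two, Real.dist_eq, sq_abs,
    AffineMap.lineMap_apply, vsub_eq_sub, vadd_eq_add, PiLp.add_apply, PiLp.smul_apply,
    PiLp.sub_apply, smul_eq_mul]
  repeat rw [Real.sq_sqrt (by positivity)]
  ring

namespace IsGeodesicFromTo

variable {X : Type*} [MetricSpace X] {c : ℝ → X} {x y : X}

theorem dist_start (hc : IsGeodesicFromTo c x y) {t : ℝ} (ht : t ∈ Icc 0 (dist x y)) :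
    dist x (c t) = t := by
  have h := hc.isometry 0 ⟨le_rfl, dist_nonneg⟩ t ht
  rwa [hc.start, zero_sub, abs_neg, abs_of_nonneg ht.1] at h

theorem dist_finish (hc : IsGeodesicFromTo c x y) {t : ℝ} (ht : t ∈ Icc 0 (dist x y)) :
    dist (c t) y = dist x y - t := by
  have h := hc.isometry t ht _ ⟨dist_nonneg, le_rfl⟩
  rwa [hc.finish, abs_sub_comm, abs_of_nonneg (sub_nonneg.2 ht.2)] at h

theorem initial (hc : IsGeodesicFromTo c x y) {t : ℝ} (ht : t ∈ Icc 0 (dist x y)) :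
    IsGeodesicFromTo c x (c t) := by
  refine ⟨hc.start, by rw [hc.dist_start ht], ?_⟩
  rw [hc.dist_start ht]
  exact fun s hs t' ht' => hc.isometry s ⟨hs.1, hs.2.trans ht.2⟩ t' ⟨ht'.1, ht'.2.trans ht.2⟩

theorem continuousOn (hc : IsGeodesicFromTo c x y) : ContinuousOn c (Icc 0 (dist x y)) := by
  refine LipschitzOnWith.continuousOn (K := 1) (LipschitzOnWith.of_dist_le_mul ?_)
  intro s hs t ht
  rw [hc.isometry s hs t ht, Real.dist_eq]
  simp

end IsGeodesicFromTo

namespace IsCAT0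

variable {X : Type*} [MetricSpace X]

/-- The inequality of Bruhat and Tits for an arbitrary point of a geodesic, with denominators
cleared: the squared distance from `p` is at most what it is in the plane. -/
theorem dist_sq_le (hX : IsCAT0 X) {c : ℝ → X} {q r : X} (hc : IsGeodesicFromTo c q r) (p : X)
    {t : ℝ} (ht : t ∈ Icc 0 (dist q r)) :
    dist q r * dist p (c t) ^ 2 ≤ (dist q r - t) * dist p q ^ 2 + t * dist p r ^ 2
      - t * (dist q r - t) * dist q r := by
  rcases (dist_nonneg (x := q) (y := r)).eq_or_lt with h0 | hpos
  · have : t = 0 := le_antisymm (h0 ▸ ht.2) ht.1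
    subst this
    simp [← h0]
  obtain ⟨q', r', p', h₁, h₂, h₃⟩ := exists_comparison_triangle hpos
    (dist_nonneg (x := q) (y := p)) (dist_nonneg (x := r) (y := p))
    (by rw [dist_comm r p]; exact dist_triangle q p r) (dist_triangle q r p)
    (by rw [dist_comm q r]; exact dist_triangle r q p)
  obtain ⟨c', hc'⟩ := hX.exists_geodesic q p
  set A := dist q r
  have hs : t / A ∈ Icc (0 : ℝ) 1 :=
    ⟨div_nonneg ht.1 hpos.le, (div_le_one hpos).2 ht.2⟩
  have hx' : AffineMap.lineMap q' r' (t / A) ∈ segment ℝ q' r' := by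
    rw [segment_eq_image_lineMap]; exact mem_image_of_mem _ hs
  have hd : dist q' (AffineMap.lineMap q' r' (t / A)) = t := by
    rw [dist_left_lineMap, h₁, Real.norm_of_nonneg hs.1]
    field_simp
  have key := hX.comparison q r p c c' hc hc' q' r' p' h₁ h₂ h₃ _ hx' p'
    (right_mem_segment ℝ q' p') t _ hd rfl
  rw [h₂, hc'.finish, dist_comm] at key
  have h4 := dist_sq_lineMap p' q' r' (t / A)
  rw [dist_comm p' q', dist_comm p' r', h₁, h₂, h₃] at h4
  have h5 : dist p (c t) ^ 2 ≤ _ := (pow_le_pow_left₀ dist_nonneg key 2).trans_eq h4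
  have h6 := mul_le_mul_of_nonneg_left h5 hpos.le
  refine h6.trans_eq ?_
  rw [dist_comm p q, dist_comm p r]
  field_simp

/-- Two geodesics that issue from the same point converge, towards that point, at least as fast
as in the plane. -/
theorem dist_proportional_le (hX : IsCAT0 X) {c c' : ℝ → X} {x y z : X}
    (hc : IsGeodesicFromTo c x y) (hc' : IsGeodesicFromTo c' x z) {s : ℝ} (hs : s ∈ Icc (0 : ℝ) 1) :
    dist (c (s * dist x y)) (c' (s * dist x z)) ≤ s * dist y z := by
  have hmem : ∀ d : ℝ, 0 ≤ d → s * d ∈ Icc 0 d := fun d hd =>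
    ⟨mul_nonneg hs.1 hd, mul_le_of_le_one_left hd hs.2⟩
  have m₁ := hmem _ (dist_nonneg (x := x) (y := y))
  have m₂ := hmem _ (dist_nonneg (x := x) (y := z))
  have d₁ := hc.dist_start m₁
  set a := c (s * dist x y)
  rcases (dist_nonneg (x := x) (y := y)).eq_or_lt with h0 | hy
  · have hxy : x = y := dist_eq_zero.1 h0.symm
    subst hxy
    have : a = x := by simp only [a, dist_self, mul_zero, hc.start]
    rw [this, hc'.dist_start m₂]
  rcases (dist_nonneg (x := x) (y := z)).eq_or_lt with h0 | hz
  · have hxz : x = z := dist_eq_zero.1 h0.symm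
    subst hxz
    simp only [dist_self, mul_zero, hc'.start]
    rw [dist_comm, d₁, dist_comm]
  have e₁ := hX.dist_sq_le hc' a m₂
  have e₂ := hX.dist_sq_le hc z m₁
  rw [dist_comm a x, d₁] at e₁
  rw [dist_comm z a, dist_comm z x, dist_comm z y] at e₂
  have f₂ : dist a z ^ 2 ≤ (1 - s) * dist x z ^ 2 + s * dist y z ^ 2
      - s * (1 - s) * dist x y ^ 2 := by
    refine le_of_mul_le_mul_left (e₂.trans_eq ?_) hy
    ring
  have f₁ : dist a (c' (s * dist x z)) ^ 2 ≤ (1 - s) * (s * dist x y) ^ 2 + s * dist a z ^ 2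
      - s * (1 - s) * dist x z ^ 2 := by
    refine le_of_mul_le_mul_left (e₁.trans_eq ?_) hz
    ring
  refine abs_le_of_sq_le_sq' ?_ (mul_nonneg hs.1 dist_nonneg) |>.2
  nlinarith [mul_le_mul_of_nonneg_left f₂ hs.1]

end IsCAT0

end

/-! ### Slimness of Morse sets -/

section

theorem IsQuasiGeodesic.of_forall_le {X : Type*} [MetricSpace X] {K a b : ℝ} {σ : ℝ → X}
    (hK : 1 ≤ K)
    (h : ∀ s t, a ≤ s → s ≤ t → t ≤ b → dist (σ s) (σ t) ≤ t - s ∧ t - s ≤ K * dist (σ s) (σ t)) :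
    IsQuasiGeodesic K 0 (Icc a b) σ := by
  have key : ∀ s ∈ Icc a b, ∀ t ∈ Icc a b,
      dist (σ s) (σ t) ≤ |s - t| ∧ |s - t| ≤ K * dist (σ s) (σ t) := by
    intro s hs t ht
    rcases le_total s t with hst | hst
    · rw [abs_sub_comm, abs_of_nonneg (sub_nonneg.2 hst)]
      exact h s t hs.1 hst ht.2
    · rw [abs_of_nonneg (sub_nonneg.2 hst), dist_comm]
      exact h t s ht.1 hst hs.2
  refine ⟨hK, le_rfl, ordConnected_Icc, fun s hs t ht => ?_, fun s hs t ht => ?_⟩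
  · rw [sub_zero, div_le_iff₀ (by linarith), mul_comm]
    exact (key s hs t ht).2
  · have := (key s hs t ht).1
    nlinarith [abs_nonneg (s - t)]

variable {X : Type*} [MetricSpace X]

theorem IsGeodesicFromTo.isCompact_image {c : ℝ → X} {x y : X} (hc : IsGeodesicFromTo c x y) :
    IsCompact (c '' Icc 0 (dist x y)) :=
  isCompact_Icc.image_of_continuousOn hc.continuousOn

theorem IsGeodesicFromTo.image_nonempty {c : ℝ → X} {x y : X} (_ : IsGeodesicFromTo c x y) :
    (c '' Icc 0 (dist x y)).Nonempty :=
  ⟨c 0, mem_image_of_mem _ ⟨le_rfl, dist_nonneg⟩⟩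

/-- Along one side of a triangle the distance to another side grows as one moves away from the
common vertex. -/
theorem IsCAT0.infDist_geodesic_mono (hX : IsCAT0 X) {c c' : ℝ → X} {x y z : X}
    (hc : IsGeodesicFromTo c x y) (hc' : IsGeodesicFromTo c' x z) {u u' : ℝ} (hu : 0 ≤ u)
    (huu' : u ≤ u') (hu' : u' ≤ dist x z) :
    Metric.infDist (c' u) (c '' Icc 0 (dist x y)) ≤
      Metric.infDist (c' u') (c '' Icc 0 (dist x y)) := by
  rcases (hu.trans huu').eq_or_lt with h0 | hpos
  · rw [le_antisymm (huu'.trans_eq h0.symm) hu, ← h0]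
  obtain ⟨_, ⟨τ, hτ, rfl⟩, hw⟩ :=
    hc.isCompact_image.exists_infDist_eq_dist hc.image_nonempty (c' u')
  have hu'm : u' ∈ Icc 0 (dist x z) := ⟨hpos.le, hu'⟩
  have hs : u / u' ∈ Icc (0 : ℝ) 1 := ⟨by positivity, (div_le_one hpos).2 huu'⟩
  have h := hX.dist_proportional_le (hc'.initial hu'm) (hc.initial hτ) hs
  rw [hc'.dist_start hu'm, hc.dist_start hτ, div_mul_cancel₀ _ hpos.ne'] at h
  have hm : u / u' * τ ∈ Icc 0 (dist x y) :=
    ⟨mul_nonneg hs.1 hτ.1, (mul_le_of_le_one_left hτ.1 hs.2).trans hτ.2⟩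
  refine (Metric.infDist_le_dist_of_mem (mem_image_of_mem c hm)).trans (h.trans ?_)
  rw [hw]
  exact mul_le_of_le_one_left dist_nonneg hs.2

/-- Let `c` and `c'` be geodesics from `x` to `y` and to `p`. A quasi-geodesic with uniform
constants leads from `p` along `c'` towards `x`, crosses over to `c` and follows `c` to `y`. It
leaves `c'` where the distance `t₀` covered so far equals the distance that remains to `c`, so that
`t₀` is at least half the distance from `p` to `c`. -/
theorem IsCAT0.exists_quasiGeodesic_detour (hX : IsCAT0 X) {c c' : ℝ → X} {x y p : X}
    (hc : IsGeodesicFromTo c x y) (hc' : IsGeodesicFromTo c' x p) :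
    ∃ (ℓ t₀ : ℝ) (σ : ℝ → X), t₀ ∈ Icc 0 ℓ ∧ IsQuasiGeodesic 5 0 (Icc 0 ℓ) σ ∧ σ 0 = p ∧ σ ℓ = y ∧
      dist x (σ t₀) = dist x p - t₀ ∧ Metric.infDist p (c '' Icc 0 (dist x y)) ≤ 2 * t₀ := by
  set G := c '' Icc 0 (dist x y) with hG
  set R := dist x p with hR
  have hR0 : 0 ≤ R := dist_nonneg
  have hcpt := hc.isCompact_image
  have hne := hc.image_nonempty
  obtain ⟨t₀, ht₀, hφ⟩ : ∃ t ∈ Icc 0 R, Metric.infDist (c' (R - t)) G - t = 0 := by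
    have hcont : ContinuousOn (fun t => Metric.infDist (c' (R - t)) G - t) (Icc 0 R) := by
      refine ContinuousOn.sub ?_ continuousOn_id
      refine (Metric.continuous_infDist_pt G).comp_continuousOn
        (hc'.continuousOn.comp (by fun_prop) fun t ht => ?_)
      exact ⟨sub_nonneg.2 ht.2, by linarith [ht.1]⟩
    refine intermediate_value_Icc' hR0 hcont ⟨?_, ?_⟩
    · have hx : Metric.infDist (c' (R - R)) G = 0 := by
        rw [sub_self, hc'.start]
        exact Metric.infDist_zero_of_mem ⟨0, ⟨le_rfl, dist_nonneg⟩, hc.start⟩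
      simp only [hx]
      linarith
    · simpa using Metric.infDist_nonneg
  have hA : ∀ s ∈ Icc 0 t₀, R - s ∈ Icc 0 R := fun s hs =>
    ⟨by linarith [hs.2, ht₀.2], by linarith [hs.1]⟩
  set a := c' (R - t₀) with ha
  have hfa : Metric.infDist a G = t₀ := by linarith
  obtain ⟨b, ⟨τ, hτ, hcτ⟩, hb⟩ := hcpt.exists_infDist_eq_dist hne a
  have hab : dist a b = t₀ := by rw [← hb, hfa]
  have hbG : b ∈ G := ⟨τ, hτ, hcτ⟩
  obtain ⟨e, he⟩ := hX.exists_geodesic a b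
  have he1 := fun v (hv : v ∈ Icc 0 t₀) => he.dist_start (t := v) (by rwa [hab])
  have he2 := fun v (hv : v ∈ Icc 0 t₀) => he.dist_finish (t := v) (by rwa [hab])
  have he3 : ∀ v ∈ Icc 0 t₀, ∀ v' ∈ Icc 0 t₀, dist (e v) (e v') = |v - v'| := by
    have := he.isometry
    rwa [hab] at this
  rw [hab] at he2
  set l := dist x y - τ with hl
  have hl0 : 0 ≤ l := sub_nonneg.2 hτ.2
  have hC : ∀ k ∈ Icc 0 l, τ + k ∈ Icc 0 (dist x y) := fun k hk =>
    ⟨add_nonneg hτ.1 hk.1, by linarith [hk.2]⟩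
  have hCG : ∀ k ∈ Icc 0 l, c (τ + k) ∈ G := fun k hk => mem_image_of_mem c (hC k hk)
  have hAA : ∀ s ∈ Icc 0 t₀, ∀ s' ∈ Icc 0 t₀, dist (c' (R - s)) (c' (R - s')) = |s - s'| := by
    intro s hs s' hs'
    rw [hc'.isometry _ (hA s hs) _ (hA s' hs'), abs_sub_comm s s']
    congr 1
    ring
  have hCC : ∀ k ∈ Icc 0 l, ∀ k' ∈ Icc 0 l, dist (c (τ + k)) (c (τ + k')) = |k - k'| := by
    intro k hk k' hk'
    rw [hc.isometry _ (hC k hk) _ (hC k' hk')]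
    congr 1
    ring
  have hbC : ∀ k ∈ Icc 0 l, dist b (c (τ + k)) = k := by
    intro k hk
    have := hCC 0 ⟨le_rfl, hl0⟩ k hk
    rwa [add_zero, hcτ, zero_sub, abs_neg, abs_of_nonneg hk.1] at this
  have hAa : ∀ s ∈ Icc 0 t₀, dist (c' (R - s)) a = t₀ - s := by
    intro s hs
    rw [ha, hAA s hs t₀ ⟨ht₀.1, le_rfl⟩, abs_sub_comm, abs_of_nonneg (sub_nonneg.2 hs.2)]
  have hfA : ∀ s ∈ Icc 0 t₀, t₀ ≤ Metric.infDist (c' (R - s)) G := by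
    intro s hs
    rw [← hfa]
    exact hX.infDist_geodesic_mono hc hc' (by linarith [ht₀.2]) (by linarith [hs.2])
      (by linarith [hs.1])
  have hBC : ∀ v ∈ Icc 0 t₀, ∀ k ∈ Icc 0 l, t₀ - v ≤ dist (e v) (c (τ + k)) := by
    intro v hv k hk
    have h₁ := Metric.infDist_le_infDist_add_dist (s := G) (x := a) (y := e v)
    have h₂ := Metric.infDist_le_dist_of_mem (x := e v) (hCG k hk)
    rw [hfa, he1 v hv] at h₁
    linarith
  have hAB : ∀ s ∈ Icc 0 t₀, ∀ v ∈ Icc 0 t₀, v ≤ dist (c' (R - s)) (e v) := by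
    intro s hs v hv
    have h₁ := Metric.infDist_le_infDist_add_dist (s := G) (x := c' (R - s)) (y := e v)
    have h₂ := Metric.infDist_le_dist_of_mem (x := e v) hbG
    rw [he2 v hv] at h₂
    linarith [hfA s hs]
  have hAC : ∀ s ∈ Icc 0 t₀, ∀ k ∈ Icc 0 l, t₀ ≤ dist (c' (R - s)) (c (τ + k)) := fun s hs k hk =>
    (hfA s hs).trans (Metric.infDist_le_dist_of_mem (hCG k hk))
  refine ⟨2 * t₀ + l, t₀, fun s => if s ≤ t₀ then c' (R - s) else if s ≤ 2 * t₀ then e (s - t₀)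
    else c (τ + (s - 2 * t₀)), ⟨ht₀.1, by linarith [ht₀.1]⟩,
    .of_forall_le (by norm_num) fun s t hs hst ht => ?_, ?_, ?_, ?_, ?_⟩
  · by_cases hs₁ : s ≤ t₀
    · have ms : s ∈ Icc 0 t₀ := ⟨hs, hs₁⟩
      by_cases ht₁ : t ≤ t₀
      · simp only [hs₁, ht₁, if_true]
        rw [hAA s ms t ⟨hs.trans hst, ht₁⟩, abs_sub_comm, abs_of_nonneg (sub_nonneg.2 hst)]
        constructor <;> linarith
      by_cases ht₂ : t ≤ 2 * t₀
      · simp only [hs₁, ht₁, ht₂, if_true, if_false]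
        have mt : t - t₀ ∈ Icc 0 t₀ := ⟨by linarith, by linarith⟩
        have := hAB s ms _ mt
        have h₁ := he1 _ mt
        have h₂ := hAa s ms
        have h₃ := dist_triangle (c' (R - s)) a (e (t - t₀))
        have h₄ := dist_triangle_right (c' (R - s)) a (e (t - t₀))
        constructor <;> linarith
      · simp only [hs₁, ht₁, ht₂, if_true, if_false]
        have mt : t - 2 * t₀ ∈ Icc 0 l := ⟨by linarith, by linarith⟩
        have h₁ := hAC s ms _ mt
        have h₂ := hAa s ms
        have h₃ := hbC _ mt
        have h₄ := dist_triangle4 (c' (R - s)) a b (c (τ + (t - 2 * t₀)))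
        have h₅ := dist_triangle4 b a (c' (R - s)) (c (τ + (t - 2 * t₀)))
        rw [dist_comm b a, dist_comm a (c' (R - s))] at h₅
        constructor <;> linarith
    · have ht₁ : ¬ t ≤ t₀ := fun h => hs₁ (hst.trans h)
      by_cases hs₂ : s ≤ 2 * t₀
      · have ms : s - t₀ ∈ Icc 0 t₀ := ⟨by linarith, by linarith⟩
        by_cases ht₂ : t ≤ 2 * t₀
        · simp only [hs₁, ht₁, hs₂, ht₂, if_true, if_false]
          rw [he3 _ ms _ ⟨by linarith, by linarith⟩, abs_sub_comm,
            abs_of_nonneg (by linarith)]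
          constructor <;> linarith
        · simp only [hs₁, ht₁, hs₂, ht₂, if_true, if_false]
          have mt : t - 2 * t₀ ∈ Icc 0 l := ⟨by linarith, by linarith⟩
          have h₁ := hBC _ ms _ mt
          have h₂ := he2 _ ms
          have h₃ := hbC _ mt
          have h₄ := dist_triangle (e (s - t₀)) b (c (τ + (t - 2 * t₀)))
          have h₅ := dist_triangle_left b (c (τ + (t - 2 * t₀))) (e (s - t₀))
          constructor <;> linarith
      · have ht₂ : ¬ t ≤ 2 * t₀ := fun h => hs₂ (hst.trans h)
        simp only [hs₁, ht₁, hs₂, ht₂, if_false]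
        rw [hCC _ ⟨by linarith, by linarith⟩ _ ⟨by linarith, by linarith⟩, abs_sub_comm,
          abs_of_nonneg (by linarith)]
        constructor <;> linarith
  · simp only [ht₀.1, if_true, sub_zero]
    exact hc'.finish
  · have hy : c (τ + l) = y := by rw [hl, add_sub_cancel, hc.finish]
    rcases hl0.eq_or_lt with h0 | hlpos
    · -- the last piece is a single point, and `y` is reached by an earlier one
      rw [← h0, add_zero, hcτ] at hy
      rcases ht₀.1.eq_or_lt with h1 | h1
      · have hab' : a = b := dist_eq_zero.1 (by rw [hab, ← h1])
        rw [← hy, ← hab', ha, ← h0, ← h1]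
        simp
      · beta_reduce
        rw [if_neg (by linarith), if_pos (by linarith), ← h0, ← hy]
        have := he.finish
        rw [hab] at this
        convert this using 2
        ring
    · beta_reduce
      rw [if_neg (by linarith [ht₀.1]), if_neg (by linarith), add_sub_cancel_left, hy]
  · beta_reduce
    rw [if_pos le_rfl]
    exact hc'.dist_start (hA t₀ ⟨ht₀.1, le_rfl⟩)
  · have h := Metric.infDist_le_infDist_add_dist (s := G) (x := p) (y := a)
    have hp := hAa 0 ⟨le_rfl, ht₀.1⟩
    rw [sub_zero, hc'.finish] at hp
    linarith

/-- A point `p` of a Morse set that is almost nearest to `x` lies close to every geodesic from `x`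
to the set. -/
theorem IsMorse.exists_slim (hX : IsCAT0 X) {S : Set X} (hS : IsMorse S) :
    ∃ δ : ℝ, 0 < δ ∧ ∀ (x p y : X) (c : ℝ → X), p ∈ S → y ∈ S →
      dist x p ≤ Metric.infDist x S + 1 → IsGeodesicFromTo c x y →
      ∃ t ∈ Icc 0 (dist x y), dist p (c t) ≤ δ := by
  obtain ⟨M, hM⟩ := hS 5 0
  refine ⟨2 * max M 0 + 2, by positivity, fun x p y c hp hy hxp hc => ?_⟩
  obtain ⟨c', hc'⟩ := hX.exists_geodesic x p
  obtain ⟨ℓ, t₀, σ, ht₀, hσ, h0, hℓ, hd, hle⟩ := hX.exists_quasiGeodesic_detour hc hc'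
  have h₁ := hM 0 ℓ σ (ht₀.1.trans ht₀.2) hσ (h0 ▸ hp) (hℓ ▸ hy) t₀ ht₀
  have h₂ := Metric.infDist_le_infDist_add_dist (s := S) (x := x) (y := σ t₀)
  obtain ⟨_, ⟨t, ht, rfl⟩, hw⟩ := hc.isCompact_image.exists_infDist_eq_dist hc.image_nonempty p
  refine ⟨t, ht, ?_⟩
  rw [← hw]
  linarith [le_max_left M 0]

end

/-! ### Morse sets are strongly contracting -/

section

variable {X : Type*} [MetricSpace X]

/-- Strong contraction for almost nearest points: points of `S` whose distance from `x` exceeds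
the distance of `S` by at most `1` serve as projections of `x`. Unlike nearest points they always
exist. -/
def IsCoarselyContracting (c : ℝ) (S : Set X) : Prop :=
  ∀ x y p q : X, p ∈ S → q ∈ S → dist x p ≤ Metric.infDist x S + 1 →
    dist y q ≤ Metric.infDist y S + 1 → dist x y < Metric.infDist x S → dist p q ≤ c

/-- The Euclidean comparison of `y` with the geodesic `[x, q]` leaves no room for `p` and `q` to
be far apart when both geodesics `[x, q]` and `[y, p]` pass close to the projections `p` and
`q`. -/
theorem IsMorse.exists_isCoarselyContracting (hX : IsCAT0 X) {S : Set X} (hS : IsMorse S) :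
    ∃ c : ℝ, 0 < c ∧ IsCoarselyContracting c S := by
  obtain ⟨δ, hδ, hslim⟩ := hS.exists_slim hX
  refine ⟨4 * δ, by positivity, fun x y p q hp hq hxp hyq hxy => ?_⟩
  by_contra! hc
  obtain ⟨g, hg⟩ := hX.exists_geodesic x q
  obtain ⟨g', hg'⟩ := hX.exists_geodesic y p
  obtain ⟨t, ht, hpt⟩ := hslim x p q g hp hq hxp hg
  obtain ⟨t', ht', hqt⟩ := hslim y q p g' hq hp hyq hg'
  have hCN := hX.dist_sq_le hg y ht
  have hα := hg.dist_start ht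
  have hβ := hg.dist_finish ht
  have hα' := hg'.dist_start ht'
  have hβ' := hg'.dist_finish ht'
  obtain ⟨β, hAβ⟩ : ∃ β, dist x q = t + β := ⟨dist x q - t, by ring⟩
  have hR : Metric.infDist x S ≤ dist x p := Metric.infDist_le_dist_of_mem hp
  have k₁ : dist x p ≤ t + δ := by
    have := dist_triangle_right x p (g t)
    linarith
  have k₂ : dist p q - δ ≤ β := by
    have := dist_triangle p (g t) q
    linarith
  have k₃ : dist y q + dist p q - 3 * δ ≤ dist y (g t) := by
    have h₁ := dist_triangle_right y q (g' t')
    have h₂ := dist_triangle_left p q (g' t')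
    have h₃ := dist_triangle_right y p (g t)
    rw [dist_comm (g' t') q] at h₂
    linarith
  rw [hAβ, dist_comm y x] at hCN
  have ht0 := ht.1
  set e := dist p q - 3 * δ with he
  have heδ : δ < e := by linarith
  have hβδ : 3 * δ < β := by linarith
  have k₄ : dist y q ^ 2 + e ^ 2 ≤ dist y (g t) ^ 2 := by
    have : (dist y q + e) ^ 2 ≤ dist y (g t) ^ 2 :=
      pow_le_pow_left₀ (add_nonneg dist_nonneg (hδ.trans heδ).le) (by linarith) 2
    nlinarith [mul_nonneg (dist_nonneg (x := y) (y := q)) (hδ.trans heδ).le]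
  have k₅ : dist x y ^ 2 ≤ (t + δ) ^ 2 := pow_le_pow_left₀ dist_nonneg (by linarith) 2
  have k₆ := mul_le_mul_of_nonneg_left k₄ (by linarith : 0 ≤ t + β)
  have k₇ := mul_le_mul_of_nonneg_left k₅ (by linarith : 0 ≤ β)
  have k₈ : 0 < β * (e ^ 2 - δ ^ 2) := mul_pos (by linarith) (by nlinarith)
  have k₉ : 0 ≤ t * β * (β - 2 * δ) :=
    mul_nonneg (mul_nonneg ht0 (by linarith)) (by linarith)
  have k₁₀ : 0 ≤ β * dist y q ^ 2 := mul_nonneg (by linarith) (sq_nonneg _)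
  have k₁₁ : 0 ≤ t * e ^ 2 := mul_nonneg ht0 (sq_nonneg _)
  have e₁ : (t + β - t) = β := by ring
  rw [e₁] at hCN
  nlinarith

theorem IsCoarselyContracting.isContracting {X : Type*} [MetricSpace X] {c : ℝ} {S : Set X}
    (h : IsCoarselyContracting c S) : IsContracting 1 (c + 1) S := by
  intro x y hxy p hp q hq
  rw [one_mul] at hxy
  exact (h x y p q hp.1 hq.1 (by linarith [hp.2]) (by linarith [hq.2]) hxy).trans_lt (lt_add_one c)

end

/-! ### Contracting sets are Morse -/

section

variable {X : Type*} [MetricSpace X]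

/-- A walk with steps short compared to `D` is followed until it comes `D`-close to `S`. Outside
the `D`-neighbourhood every step of length `η` in the parameter moves the projection by at most
`c`. -/
theorem IsContracting.exists_first_close {S : Set X} {b c D η ℓ : ℝ} {π : X → X}
    (h : IsContracting b c S) (hb : 0 ≤ b) (hπ : ∀ x, π x ∈ nearestPoints S x) (hη : 0 < η)
    (hℓ : 0 ≤ ℓ) {ρ : ℝ → X}
    (hρ : ∀ s ∈ Icc 0 ℓ, ∀ t ∈ Icc 0 ℓ, |s - t| ≤ η → dist (ρ s) (ρ t) < b * D)
    (hend : Metric.infDist (ρ ℓ) S ≤ D) :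
    ∃ (i : ℕ) (u : ℝ), u ∈ Icc 0 ℓ ∧ Metric.infDist (ρ u) S ≤ D ∧ u ≤ i * η ∧ (i - 1) * η ≤ u ∧
      dist (π (ρ 0)) (π (ρ u)) ≤ i * c := by
  classical
  have hex : ∃ i : ℕ, Metric.infDist (ρ (min ℓ (i * η))) S ≤ D := by
    obtain ⟨i, hi⟩ := exists_nat_ge (ℓ / η)
    refine ⟨i, ?_⟩
    rwa [min_eq_left ((div_le_iff₀ hη).1 hi)]
  have hmem : ∀ i : ℕ, min ℓ (i * η) ∈ Icc 0 ℓ := fun i =>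
    ⟨le_min hℓ (by positivity), min_le_left _ _⟩
  have hfar : ∀ k < Nat.find hex, D < Metric.infDist (ρ (min ℓ (k * η))) S := fun k hk =>
    not_le.1 (Nat.find_min hex hk)
  have hstep : ∀ k ≤ Nat.find hex,
      dist (π (ρ 0)) (π (ρ (min ℓ (k * η)))) ≤ k * c := by
    intro k
    induction k with
    | zero => intro _; simp [hℓ]
    | succ k ih =>
      intro hk
      have h₁ := ih (by omega)
      have h₂ : dist (ρ (min ℓ (k * η))) (ρ (min ℓ ((k + 1 : ℕ) * η))) < b * D := by
        refine hρ _ (hmem k) _ (hmem (k + 1)) ?_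
        refine (abs_min_sub_min_le_max _ _ _ _).trans ?_
        rw [sub_self, abs_zero, ← sub_mul, Nat.cast_succ, sub_add_cancel_left]
        simp [abs_of_pos hη, hη.le]
      have h₃ := h _ _ (h₂.trans_le (mul_le_mul_of_nonneg_left (hfar k (by omega)).le hb)) _
        (hπ _) _ (hπ _)
      have h₄ := dist_triangle (π (ρ 0)) (π (ρ (min ℓ (k * η)))) (π (ρ (min ℓ ((k + 1 : ℕ) * η))))
      push_cast at h₃ h₄ ⊢
      linarith
  refine ⟨Nat.find hex, _, hmem _, Nat.find_spec hex, min_le_right _ _, ?_, hstep _ le_rfl⟩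
  rcases hi : Nat.find hex with _ | k
  · simp only [Nat.cast_zero, zero_sub, neg_mul, one_mul, zero_mul]
    exact (neg_nonpos.2 hη.le).trans (le_min hℓ le_rfl)
  · have hk := hfar k (by omega)
    have hlt : (k : ℝ) * η ≤ ℓ := by
      by_contra! hlt
      rw [min_eq_left hlt.le] at hk
      exact hk.not_ge hend
    push_cast
    exact le_min (by linarith) (by nlinarith)

/-- Away from a contracting set the projection of a quasi-geodesic moves more slowly than the
quasi-geodesic advances, so its excursions are short. -/
theorem IsContracting.isMorse {S : Set X} {b c : ℝ} (h : IsContracting b c S) (hb : 0 < b)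
    (hc : 0 < c) (hS : ∀ x, (nearestPoints S x).Nonempty) : IsMorse S := by
  choose π hπ using hS
  intro K L
  by_cases hKL : 1 ≤ K ∧ 0 ≤ L
  swap
  · exact ⟨0, fun a b σ _ hσ => absurd ⟨hσ.one_le, hσ.nonneg⟩ hKL⟩
  obtain ⟨hK, hL⟩ := hKL
  -- with this step length the projection advances at most at half the minimal speed `1 / K`
  set η : ℝ := 2 * K * c with hη
  have hη0 : 0 < η := by positivity
  set D : ℝ := (K * η + L + 1) / b with hD
  have hbD : b * D = K * η + L + 1 := by rw [hD]; field_simp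
  have hD0 : 0 ≤ D := by positivity
  refine ⟨2 * K ^ 2 * (2 * D + 4 * c + L) + L + D, fun a b' σ hab hσ ha hb' t ht => ?_⟩
  have hclose : ∀ s ∈ Icc a b', ∀ s' ∈ Icc a b', |s - s'| ≤ η → dist (σ s) (σ s') < b * D := by
    intro s hs s' hs' hss'
    have := hσ.upper s hs s' hs'
    rw [hbD]
    nlinarith
  obtain ⟨i, u, hu, hfu, hui, hiu, hπu⟩ := h.exists_first_close (ρ := fun s => σ (t + s)) hb.le hπ
    hη0 (sub_nonneg.2 ht.2) (D := D) (fun s hs s' hs' hss' => hclose _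
      ⟨by linarith [ht.1, hs.1], by linarith [hs.2]⟩ _
      ⟨by linarith [ht.1, hs'.1], by linarith [hs'.2]⟩ (by rwa [add_sub_add_left_eq_sub]))
    (by simpa [Metric.infDist_zero_of_mem hb'] using hD0)
  obtain ⟨j, v, hv, hfv, hvj, hjv, hπv⟩ := h.exists_first_close (ρ := fun s => σ (t - s)) hb.le hπ
    hη0 (sub_nonneg.2 ht.1) (D := D) (fun s hs s' hs' hss' => hclose _
      ⟨by linarith [hs.2], by linarith [ht.2, hs.1]⟩ _
      ⟨by linarith [hs'.2], by linarith [ht.2, hs'.1]⟩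
        (by rwa [sub_sub_sub_cancel_left, abs_sub_comm]))
    (by simpa [Metric.infDist_zero_of_mem ha] using hD0)
  simp only [add_zero, sub_zero] at hfu hπu hfv hπv
  have mu : t + u ∈ Icc a b' := ⟨by linarith [ht.1, hu.1], by linarith [hu.2]⟩
  have mv : t - v ∈ Icc a b' := ⟨by linarith [hv.2], by linarith [ht.2, hv.1]⟩
  have hlow := hσ.lower _ mv _ mu
  have e₁ : |t - v - (t + u)| = u + v := by
    rw [abs_sub_comm, abs_of_nonneg (by linarith [hu.1, hv.1])]
    ring
  rw [e₁] at hlow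
  have hup : dist (σ (t - v)) (σ (t + u)) ≤ 2 * D + (i + j) * c := by
    have d₁ := (hπ (σ (t + u))).2
    have d₂ := (hπ (σ (t - v))).2
    have d₃ := dist_triangle4 (σ (t - v)) (π (σ (t - v))) (π (σ (t + u))) (σ (t + u))
    have d₄ := dist_triangle_left (π (σ (t - v))) (π (σ (t + u))) (π (σ t))
    rw [dist_comm (π (σ (t + u))) (σ (t + u))] at d₃
    linarith
  have hij : (i + j) * c ≤ 2 * D + 4 * c + L := by
    have : (i + j - 2) * (2 * c) ≤ (u + v) / K := by
      rw [le_div_iff₀ (by linarith)]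
      rw [hη] at hiu hjv
      linarith
    linarith
  have hic : (i : ℝ) * c ≤ 2 * D + 4 * c + L := by
    have : (0 : ℝ) ≤ j * c := by positivity
    linarith
  have d₁ := hσ.upper _ ht _ mu
  have e₂ : |t - (t + u)| = u := by rw [abs_sub_comm, add_sub_cancel_left, abs_of_nonneg hu.1]
  rw [e₂] at d₁
  have d₂ := Metric.infDist_le_infDist_add_dist (s := S) (x := σ t) (y := σ (t + u))
  have d₃ : K * u ≤ 2 * K ^ 2 * (2 * D + 4 * c + L) := by
    have : u ≤ 2 * K * (2 * D + 4 * c + L) := by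
      rw [hη] at hui
      nlinarith
    nlinarith
  linarith

end

/-! ### Paths that cross a contracting quasi-geodesic at a distance -/

section

variable {X : Type*} [MetricSpace X]

/-- A discrete path that runs from before the parameter `m - ρ` of `γ` to beyond the parameter `m`,
in short steps and far from `γ m`, needs many moves of length at least `H`. Indeed, while its
projection has parameter within `ρ` of `m`, the path is at distance at least `H` from `γ`, and by
contraction the projection advances by less than `K * (c + L) + 1` unless the path moves by `H`.
The indices `j k` are those at which the projection first passes equally spaced parameters. -/
theorem IsCoarselyContracting.exists_crossings {K L c m ρ H η s t : ℝ} {I : Set ℝ} {γ : ℝ → X}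
    (hγ : IsQuasiGeodesic K L I γ) (hcon : IsCoarselyContracting c (γ '' I)) (hc : 0 ≤ c)
    {x : ℕ → X} {N : ℕ} (hNpos : 0 < N) (hs : s ∈ I) (ht : t ∈ I) (hm : m ∈ I)
    (hx0 : x 0 = γ s) (hxN : x N = γ t) (hsm : s ≤ m - ρ) (hmt : m ≤ t)
    (hfar : ∀ i ≤ N, H + K * ρ + L + 1 ≤ dist (x i) (γ m))
    (hstep : ∀ i < N, dist (x i) (x (i + 1)) ≤ η) (hη : 0 ≤ η) (hηH : η < H)
    (hηρ : K * (4 * η + 2 + c + L) ≤ ρ) {n : ℕ} (hn : n * (2 * (K * (c + L) + 1)) ≤ ρ) :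
    ∃ j : ℕ → ℕ, (∀ k < n, j k < j (k + 1)) ∧ (∀ k ≤ n, j k ≤ N) ∧
      ∀ k < n, H ≤ dist (x (j k)) (x (j (k + 1))) := by
  have hK := hγ.one_le
  have hL := hγ.nonneg
  have hSne : (γ '' I).Nonempty := ⟨γ m, mem_image_of_mem γ hm⟩
  obtain ⟨τ, hτI, hτp, hτ0, hτN⟩ : ∃ τ : ℕ → ℝ, (∀ i, τ i ∈ I) ∧
      (∀ i, dist (x i) (γ (τ i)) ≤ Metric.infDist (x i) (γ '' I) + 1) ∧ τ 0 = s ∧ τ N = t := by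
    have hex : ∀ i, ∃ a ∈ I, dist (x i) (γ a) ≤ Metric.infDist (x i) (γ '' I) + 1 := by
      intro i
      obtain ⟨_, ⟨a, ha, rfl⟩, h⟩ := (Metric.infDist_lt_iff hSne).1
        (lt_add_one (Metric.infDist (x i) (γ '' I)))
      exact ⟨a, ha, h.le⟩
    choose τ hτI hτp using hex
    refine ⟨fun i => if i = 0 then s else if i = N then t else τ i, fun i => ?_, fun i => ?_,
      by simp, by simp [hNpos.ne']⟩
    · beta_reduce
      split_ifs
      exacts [hs, ht, hτI i]
    · beta_reduce
      split_ifs with h₁ h₂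
      · rw [h₁, hx0, dist_self]
        linarith [Metric.infDist_nonneg (x := γ s) (s := γ '' I)]
      · rw [h₂, hxN, dist_self]
        linarith [Metric.infDist_nonneg (x := γ t) (s := γ '' I)]
      · exact hτp i
  set e : ℝ := K * (c + L) + 1 with he
  have he1 : 1 ≤ e := by
    have : 0 ≤ K * (c + L) := by positivity
    linarith
  have hρ0 : 0 ≤ ρ := le_trans (by positivity) hηρ
  have hwindow : ∀ i ≤ N, m - ρ ≤ τ i → τ i ≤ m → H ≤ Metric.infDist (x i) (γ '' I) := by
    intro i hi h₁ h₂
    have h₃ := hγ.upper _ (hτI i) m hm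
    have h₄ : K * |τ i - m| ≤ K * ρ :=
      mul_le_mul_of_nonneg_left (abs_le.2 ⟨by linarith, by linarith⟩) (by linarith)
    have h₅ := dist_triangle (x i) (γ (τ i)) (γ m)
    linarith [hτp i, hfar i hi]
  have hparam : ∀ i i' (B : ℝ), dist (γ (τ i)) (γ (τ i')) ≤ B → |τ i - τ i'| ≤ K * (B + L) := by
    intro i i' B hB
    have h₁ := hγ.lower _ (hτI i) _ (hτI i')
    rw [sub_le_iff_le_add, div_le_iff₀ (by linarith), mul_comm] at h₁
    exact h₁.trans (mul_le_mul_of_nonneg_left (by linarith) (by linarith))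
  have hslow : ∀ i i', dist (x i) (x i') < Metric.infDist (x i) (γ '' I) →
      |τ i - τ i'| ≤ e - 1 := by
    intro i i' h
    have := hparam i i' c (hcon _ _ _ _ (mem_image_of_mem γ (hτI i)) (mem_image_of_mem γ (hτI i'))
      (hτp i) (hτp i') h)
    rwa [he, add_sub_cancel_right]
  have hcoarse : ∀ i < N, |τ i - τ (i + 1)| ≤ ρ := by
    intro i hi
    refine (hparam i (i + 1) (4 * η + 2 + c) ?_).trans hηρ
    rcases lt_or_ge (dist (x i) (x (i + 1))) (Metric.infDist (x i) (γ '' I)) with h | h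
    · have := hcon _ _ _ _ (mem_image_of_mem γ (hτI i)) (mem_image_of_mem γ (hτI (i + 1)))
        (hτp i) (hτp _) h
      linarith
    · have h₁ := Metric.infDist_le_infDist_add_dist (s := γ '' I) (x := x (i + 1)) (y := x i)
      rw [dist_comm (x (i + 1))] at h₁
      have h₂ := dist_triangle4 (γ (τ i)) (x i) (x (i + 1)) (γ (τ (i + 1)))
      rw [dist_comm (γ (τ i)) (x i)] at h₂
      linarith [hτp i, hτp (i + 1), hstep i hi]
  have hlevel : ∀ k ≤ n, m - ρ + k * (2 * e) ≤ m := by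
    intro k hk
    have : (k : ℝ) * (2 * e) ≤ n * (2 * e) :=
      mul_le_mul_of_nonneg_right (by exact_mod_cast hk) (by linarith)
    linarith
  have hlevel' : ∀ k : ℕ, m - ρ ≤ m - ρ + k * (2 * e) := fun k =>
    le_add_of_nonneg_right (by positivity)
  -- `i` is the first index at which the projection has passed the `k`-th level
  have hfirst : ∀ k : ℕ, ∃ i : ℕ, k ≤ n → i ≤ N ∧ m - ρ + k * (2 * e) ≤ τ i ∧
      τ i ≤ m - ρ + k * (2 * e) + e ∧ ∀ i' < i, τ i' < m - ρ + k * (2 * e) := by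
    classical
    intro k
    by_cases hk : k ≤ n
    swap
    · exact ⟨0, fun h => absurd h hk⟩
    have hex : ∃ i, m - ρ + k * (2 * e) ≤ τ i := ⟨N, by linarith [hlevel k hk]⟩
    have hle : Nat.find hex ≤ N := Nat.find_min' hex (by linarith [hlevel k hk])
    refine ⟨Nat.find hex, fun _ => ⟨hle, Nat.find_spec hex, ?_,
      fun i' hi' => not_le.1 (Nat.find_min hex hi')⟩⟩
    rcases hi : Nat.find hex with _ | i
    · linarith [hlevel' k]
    have hlt : τ i < m - ρ + k * (2 * e) := not_le.1 (Nat.find_min hex (by omega))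
    have hge : m - ρ + k * (2 * e) ≤ τ (i + 1) := hi ▸ Nat.find_spec hex
    have h₁ := hstep i (by omega)
    have h₂ : |τ i - τ (i + 1)| ≤ e - 1 := by
      rcases le_or_gt (m - ρ) (τ i) with h | h
      · exact hslow _ _ (by linarith [hwindow i (by omega) h (by linarith [hlevel k hk])])
      · -- the step enters the window, and cannot jump across it
        have h₃ := (abs_le.1 (hcoarse i (by omega))).1
        have h₄ := hwindow (i + 1) (by omega) (by linarith [hlevel' k]) (by linarith)
        rw [abs_sub_comm]
        exact hslow _ _ (by rw [dist_comm]; linarith)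
    linarith [(abs_le.1 h₂).1]
  choose j hj using hfirst
  have hgap : ∀ k < n, τ (j k) + e ≤ τ (j (k + 1)) := by
    intro k hk
    have h₁ := (hj k hk.le).2.2.1
    have h₂ := (hj (k + 1) hk).2.1
    push_cast at h₂
    linarith
  refine ⟨j, fun k hk => ?_, fun k hk => (hj k hk).1, fun k hk => ?_⟩
  · by_contra! hle
    rcases hle.eq_or_lt with h | h
    · have := hgap k hk
      rw [h] at this
      linarith
    · have h₁ := (hj k hk.le).2.2.2 _ h
      linarith [hgap k hk, (hj k hk.le).2.1]
  · by_contra! hlt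
    obtain ⟨h₁, h₂, h₃, -⟩ := hj k hk.le
    have h₄ := hlevel (k + 1) hk
    push_cast at h₄
    have h₅ := hslow _ _ (hlt.trans_le (hwindow _ h₁ (by linarith [hlevel' k]) (by linarith)))
    linarith [(abs_le.1 h₅).1, hgap k hk]

end

/-! ### Quadratic divergence -/

section

variable {X : Type*} [MetricSpace X]

theorem Path.exists_uniform_partition {Y : Type*} [PseudoMetricSpace Y] {u v : Y} (f : Path u v)
    {η : ℝ} (hη : 0 < η) :
    ∃ N : ℕ, 0 < N ∧ ∀ i : ℕ, dist (f.extend (i / N)) (f.extend ((i + 1 : ℕ) / N)) < η := by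
  have huc : UniformContinuous f.extend :=
    (CompactSpace.uniformContinuous_of_continuous f.continuous).comp
      (LipschitzWith.projIcc _).uniformContinuous
  obtain ⟨d, hd, h⟩ := Metric.uniformContinuous_iff.1 huc η hη
  obtain ⟨N, hN⟩ := exists_nat_one_div_lt hd
  refine ⟨N + 1, N.succ_pos, fun i => h ?_⟩
  rw [Real.dist_eq, abs_sub_comm, ← sub_div, Nat.cast_succ, add_sub_cancel_left,
    abs_of_pos (by positivity)]
  exact_mod_cast hN

theorem IsCoarselyContracting.hasAtLeastQuadraticDivergence {K L c : ℝ} {γ : ℝ → X}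
    (hγ : IsQuasiGeodesic K L univ γ) (hcon : IsCoarselyContracting c (γ '' univ)) (hc : 0 ≤ c) :
    HasAtLeastQuadraticDivergence γ := by
  intro δ hδ hδ1
  have hK := hγ.one_le
  have hL := hγ.nonneg
  have hK0 : 0 < K := by linarith
  set e : ℝ := K * (c + L) + 1 with he
  have he0 : 0 < e := by positivity
  -- parameters in a window of radius `ε * r` give points within about `δ * r / 4` of `γ 0`
  set ε : ℝ := δ / (4 * K) with hε
  have hε0 : 0 < ε := by positivity
  have hKε : K * ε = δ / 4 := by rw [hε]; field_simp
  have hε1 : ε ≤ 1 := by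
    rw [hε, div_le_one (by positivity)]
    linarith
  refine ⟨ε * δ / (8 * e), by positivity, ?_⟩
  have htop := tendsto_natCast_atTop_atTop (R := ℝ)
  filter_upwards [htop.eventually_ge_atTop (4 * (L + 1) / δ), htop.eventually_gt_atTop (2 / δ),
    htop.eventually_ge_atTop (K * (4 * 1 + 2 + c + L) / ε), htop.eventually_ge_atTop (4 * e / ε)]
    with r h₁ h₂ h₃ h₄
  rw [div_le_iff₀ hδ] at h₁
  rw [div_lt_iff₀ hδ] at h₂
  rw [div_le_iff₀ hε0] at h₃ h₄
  refine le_iInf₂ fun α hα => ?_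
  obtain ⟨N, hN, hpart⟩ := α.exists_uniform_partition one_pos
  have hr : (0 : ℝ) ≤ r := Nat.cast_nonneg r
  set n := ⌊ε * r / (2 * e)⌋₊ with hn
  have hn₁ : n * (2 * e) ≤ ε * r :=
    (le_div_iff₀ (by positivity)).1 (Nat.floor_le (by positivity))
  have hn₂ : ε * r / (4 * e) ≤ n := by
    have h := Nat.lt_floor_add_one (ε * r / (2 * e))
    have h' : 1 ≤ ε * r / (4 * e) := by
      rw [le_div_iff₀ (by positivity)]
      linarith
    have h'' : ε * r / (2 * e) = 2 * (ε * r / (4 * e)) := by field_simp; norm_num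
    linarith
  obtain ⟨j, hjlt, hjN, hjd⟩ := hcon.exists_crossings (m := 0) (ρ := ε * r) (H := δ * r / 2)
    (η := 1) (s := -r) (t := r) (x := fun i => α.extend (i / N)) (N := N) (n := n) hγ hc hN
    (mem_univ _) (mem_univ _) (mem_univ _) (by simp) (by simp [hN.ne'])
    (by nlinarith) hr (fun i _ => by
      have hball := hα (projIcc 0 1 zero_le_one (i / N))
      rw [Metric.mem_ball, not_lt] at hball
      refine le_trans ?_ hball
      rw [← mul_assoc, hKε]
      linarith) (fun i _ => (hpart i).le) zero_le_one (by linarith) (by linarith) (by linarith)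
  have hu : MonotoneOn (fun k => projIcc (0 : ℝ) 1 zero_le_one (j k / N)) (Icc 0 n) := by
    intro k hk k' hk' hkk'
    refine monotone_projIcc _ (div_le_div_of_nonneg_right ?_ (Nat.cast_nonneg N))
    have : ∀ d, k + d ≤ n → j k ≤ j (k + d) := by
      intro d
      induction d with
      | zero => intro _; exact le_rfl
      | succ d ih => intro hd; exact (ih (by omega)).trans (hjlt (k + d) (by omega)).le
    obtain ⟨d, rfl⟩ := Nat.exists_eq_add_of_le hkk'
    exact_mod_cast this d hk'.2
  have hsum := eVariationOn.sum_le_of_monotoneOn_Icc (f := α) (s := univ) hu fun _ _ => mem_univ _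
  refine le_trans ?_ hsum
  have hterm : ∀ k ∈ Finset.Ico 0 n, ENNReal.ofReal (δ * r / 2) ≤
      edist (α (projIcc (0 : ℝ) 1 zero_le_one (j (k + 1) / N)))
        (α (projIcc (0 : ℝ) 1 zero_le_one (j k / N))) := by
    intro k hk
    rw [edist_dist, dist_comm]
    exact ENNReal.ofReal_le_ofReal (hjd k (Finset.mem_Ico.1 hk).2)
  refine le_trans ?_ (Finset.sum_le_sum hterm)
  rw [Finset.sum_const, Nat.card_Ico, Nat.sub_zero, ← ENNReal.ofReal_nsmul, nsmul_eq_mul]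
  refine ENNReal.ofReal_le_ofReal ?_
  have h₅ := mul_le_mul_of_nonneg_right hn₂ (by positivity : 0 ≤ δ * r / 2)
  refine le_trans (le_of_eq ?_) h₅
  field_simp
  ring

end

/-! ### Distances in asymptotic cones -/

section

namespace ConeData

variable {X : Type*} (C : ConeData X)

theorem eventually_le_scale (B : ℝ) : ∀ᶠ n in (C.ultra : Filter ℕ), B ≤ C.scale n :=
  C.scale_tendsto.eventually_ge_atTop B

theorem tendsto_const_div_scale (B : ℝ) :
    Tendsto (fun n => B / C.scale n) (C.ultra : Filter ℕ) (𝓝 0) :=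
  C.scale_tendsto.const_div_atTop B

end ConeData

variable {X : Type*} [MetricSpace X]

namespace ConeSeq

variable {C : ConeData X}

/-- A sequence at bounded rescaled distance from a sequence that represents a point of the cone
represents a point of the cone as well. -/
def ofDistLE (z : ConeSeq C) (y : ℕ → X)
    (h : ∃ B : ℝ, ∀ᶠ n in (C.ultra : Filter ℕ), dist (z.1 n) (y n) ≤ B * C.scale n) : ConeSeq C :=
  Subtype.mk y (by
    obtain ⟨B₁, h₁⟩ := z.2
    obtain ⟨B₂, h₂⟩ := h
    refine ⟨B₁ + B₂, ?_⟩
    filter_upwards [h₁, h₂] with n hn₁ hn₂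
    have hs := C.scale_pos n
    rw [div_le_iff₀ hs] at hn₁ ⊢
    linarith [dist_triangle (C.base n) (z.1 n) (y n)])

theorem ofDistLE_apply (z : ConeSeq C) (y : ℕ → X)
    (h : ∃ B : ℝ, ∀ᶠ n in (C.ultra : Filter ℕ), dist (z.1 n) (y n) ≤ B * C.scale n) (n : ℕ) :
    (z.ofDistLE y h).1 n = y n := rfl

theorem tendsto_dist_mk (y z : ConeSeq C) :
    Tendsto (fun n => dist (y.1 n) (z.1 n) / C.scale n) (C.ultra : Filter ℕ)
      (𝓝 (dist (SeparationQuotient.mk y) (SeparationQuotient.mk z))) := by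
  rw [SeparationQuotient.dist_mk]
  exact tendsto_ultraDist y z

theorem eventually_dist_lt {y z : ConeSeq C} {r : ℝ}
    (h : dist (SeparationQuotient.mk y) (SeparationQuotient.mk z) < r) :
    ∀ᶠ n in (C.ultra : Filter ℕ), dist (y.1 n) (z.1 n) < r * C.scale n := by
  filter_upwards [(tendsto_dist_mk y z).eventually_lt_const h] with n hn
  rwa [div_lt_iff₀ (C.scale_pos n)] at hn

theorem eventually_lt_dist {y z : ConeSeq C} {r : ℝ}
    (h : r < dist (SeparationQuotient.mk y) (SeparationQuotient.mk z)) :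
    ∀ᶠ n in (C.ultra : Filter ℕ), r * C.scale n < dist (y.1 n) (z.1 n) := by
  filter_upwards [(tendsto_dist_mk y z).eventually_const_lt h] with n hn
  rwa [lt_div_iff₀ (C.scale_pos n)] at hn

theorem dist_mk_le {y z : ConeSeq C} {r B : ℝ}
    (h : ∀ᶠ n in (C.ultra : Filter ℕ), dist (y.1 n) (z.1 n) ≤ r * C.scale n + B) :
    dist (SeparationQuotient.mk y) (SeparationQuotient.mk z) ≤ r := by
  have hlim := (C.tendsto_const_div_scale B).const_add r
  rw [add_zero] at hlim
  refine le_of_tendsto_of_tendsto (tendsto_dist_mk y z) hlim ?_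
  filter_upwards [h] with n hn
  have hs := C.scale_pos n
  rw [div_le_iff₀ hs, add_mul, div_mul_cancel₀ _ hs.ne']
  exact hn

theorem le_dist_mk {y z : ConeSeq C} {r B : ℝ}
    (h : ∀ᶠ n in (C.ultra : Filter ℕ), r * C.scale n - B ≤ dist (y.1 n) (z.1 n)) :
    r ≤ dist (SeparationQuotient.mk y) (SeparationQuotient.mk z) := by
  have hlim := (C.tendsto_const_div_scale B).const_sub r
  rw [sub_zero] at hlim
  refine le_of_tendsto_of_tendsto hlim (tendsto_dist_mk y z) ?_
  filter_upwards [h] with n hn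
  have hs := C.scale_pos n
  rw [le_div_iff₀ hs, sub_mul, div_mul_cancel₀ _ hs.ne']
  exact hn

end ConeSeq

end

/-! ### Cutpoints on the ultralimit of a contracting quasi-geodesic -/

section

variable {X : Type*} [MetricSpace X]

theorem SeparatedByCutpoint.symm {Y : Type*} [TopologicalSpace Y] {u v : Y}
    (h : SeparatedByCutpoint u v) : SeparatedByCutpoint v u := by
  obtain ⟨p, hu, hv, hp⟩ := h
  exact ⟨p, hv, hu, fun hj => hp hj.symm⟩

theorem exists_param_of_eventually_mem {C : ConeData X} {I : Set ℝ} {γ : ℝ → X} {z : ConeSeq C}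
    (hz : ∀ᶠ n in (C.ultra : Filter ℕ), z.1 n ∈ γ '' I) :
    ∃ a : ℕ → ℝ, ∀ᶠ n in (C.ultra : Filter ℕ), a n ∈ I ∧ γ (a n) = z.1 n := by
  have : ∀ n, ∃ a : ℝ, z.1 n ∈ γ '' I → a ∈ I ∧ γ a = z.1 n := by
    intro n
    by_cases h : z.1 n ∈ γ '' I
    · obtain ⟨a, ha⟩ := h
      exact ⟨a, fun _ => ha⟩
    · exact ⟨0, fun h' => absurd h' h⟩
  choose a ha using this
  exact ⟨a, hz.mono ha⟩

/-- The point of the cone represented by the parameters halfway between those of `z` and `w` is a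
cutpoint: a path avoiding it would give, at a large scale, a discrete path in `X` with a bounded
number of steps that crosses a long piece of `γ` far away from it. -/
theorem IsCoarselyContracting.separatedByCutpoint_of_le {K L c : ℝ} {I : Set ℝ} {γ : ℝ → X}
    (hγ : IsQuasiGeodesic K L I γ) (hcon : IsCoarselyContracting c (γ '' I)) (hc : 0 ≤ c)
    {C : ConeData X} {z w : ConeSeq C} {a b : ℕ → ℝ}
    (hne : (SeparationQuotient.mk z : AsymptoticCone C) ≠ SeparationQuotient.mk w)
    (ha : ∀ᶠ n in (C.ultra : Filter ℕ), a n ∈ I ∧ γ (a n) = z.1 n)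
    (hb : ∀ᶠ n in (C.ultra : Filter ℕ), b n ∈ I ∧ γ (b n) = w.1 n)
    (hab : ∀ᶠ n in (C.ultra : Filter ℕ), a n ≤ b n) :
    SeparatedByCutpoint (SeparationQuotient.mk z : AsymptoticCone C) (SeparationQuotient.mk w) := by
  have hK := hγ.one_le
  have hL := hγ.nonneg
  have hK0 : 0 < K := by linarith
  set d := dist (SeparationQuotient.mk z : AsymptoticCone C) (SeparationQuotient.mk w) with hd
  have hd0 : 0 < d := dist_pos.2 hne
  set m : ℕ → ℝ := fun n => (a n + b n) / 2 with hm
  have hmI : ∀ᶠ n in (C.ultra : Filter ℕ), m n ∈ I := by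
    filter_upwards [ha, hb, hab] with n h₁ h₂ h₃
    exact hγ.interval.out h₁.1 h₂.1 ⟨by simp only [hm]; linarith, by simp only [hm]; linarith⟩
  -- the rescaled length of the parameter interval is bounded above and away from zero
  have hlow : ∀ᶠ n in (C.ultra : Filter ℕ), d / (4 * K) * C.scale n ≤ b n - a n := by
    filter_upwards [ha, hb, hab, ConeSeq.eventually_lt_dist (y := z) (z := w) (r := d / 2) (by linarith),
      C.eventually_le_scale (4 * L / d)] with n h₁ h₂ h₃ h₄ h₅
    rw [div_le_iff₀ hd0] at h₅
    have h₆ := hγ.upper _ h₁.1 _ h₂.1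
    rw [h₁.2, h₂.2, abs_sub_comm, abs_of_nonneg (by linarith)] at h₆
    rw [div_mul_eq_mul_div, div_le_iff₀ (by positivity)]
    linarith
  have hupp : ∀ᶠ n in (C.ultra : Filter ℕ), b n - a n ≤ K * (d + 2) * C.scale n := by
    filter_upwards [ha, hb, hab, ConeSeq.eventually_dist_lt (y := z) (z := w) (r := d + 1) (by linarith),
      C.eventually_le_scale L] with n h₁ h₂ h₃ h₄ h₅
    have h₆ := hγ.lower _ h₁.1 _ h₂.1
    rw [h₁.2, h₂.2, abs_sub_comm, abs_of_nonneg (by linarith), sub_le_iff_le_add,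
      div_le_iff₀ hK0] at h₆
    nlinarith
  set P : ConeSeq C := z.ofDistLE (fun n => γ (m n)) ⟨K * (K * (d + 2)) + 1, by
    filter_upwards [ha, hab, hupp, hmI, C.eventually_le_scale L] with n h₁ h₃ h₄ h₅ h₆
    have h₇ := hγ.upper _ h₁.1 _ h₅
    rw [h₁.2, abs_sub_comm, abs_of_nonneg (by simp only [hm]; linarith)] at h₇
    have h₈ : m n - a n ≤ b n - a n := by simp only [hm]; linarith
    have h₉ := mul_le_mul_of_nonneg_left (h₈.trans h₄) hK0.le
    linarith⟩ with hP
  have hPz : 0 < dist (SeparationQuotient.mk P : AsymptoticCone C) (SeparationQuotient.mk z) := by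
    refine lt_of_lt_of_le (by positivity) (ConeSeq.le_dist_mk (r := d / (4 * K) / (2 * K))
      (B := L) ?_)
    filter_upwards [ha, hab, hlow, hmI] with n h₁ h₃ h₄ h₅
    have h₇ := hγ.lower _ h₅ _ h₁.1
    rw [h₁.2, abs_of_nonneg (by simp only [hm]; linarith)] at h₇
    refine le_trans (sub_le_sub_right ?_ L) h₇
    rw [le_div_iff₀ hK0, div_mul_eq_mul_div, div_mul_eq_mul_div, div_le_iff₀ (by positivity)]
    simp only [hm]
    nlinarith
  have hPw : 0 < dist (SeparationQuotient.mk P : AsymptoticCone C) (SeparationQuotient.mk w) := by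
    refine lt_of_lt_of_le (by positivity) (ConeSeq.le_dist_mk (r := d / (4 * K) / (2 * K))
      (B := L) ?_)
    filter_upwards [hb, hab, hlow, hmI] with n h₁ h₃ h₄ h₅
    have h₇ := hγ.lower _ h₅ _ h₁.1
    rw [h₁.2, abs_sub_comm, abs_of_nonneg (by simp only [hm]; linarith)] at h₇
    refine le_trans (sub_le_sub_right ?_ L) h₇
    rw [le_div_iff₀ hK0, div_mul_eq_mul_div, div_mul_eq_mul_div, div_le_iff₀ (by positivity)]
    simp only [hm]
    nlinarith
  refine ⟨SeparationQuotient.mk P, dist_pos.1 hPz, dist_pos.1 hPw, fun ⟨f, hf⟩ => ?_⟩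
  obtain ⟨ε, hε, hfε⟩ : ∃ ε > 0, ∀ t, ε ≤ dist (f t) (SeparationQuotient.mk P) := by
    obtain ⟨t, -, ht⟩ := (isCompact_univ (X := unitInterval)).exists_isMinOn univ_nonempty
      (f := fun t => dist (f t) (SeparationQuotient.mk P)) (by fun_prop)
    exact ⟨_, dist_pos.2 (hf t), fun t' => ht (mem_univ t')⟩
  -- all at the scale of the cone: the path keeps a distance `ε` from the cutpoint; a window of
  -- radius `ρ` is small against `ε` and ends before `z` and `w`; steps `η` cannot jump across it
  set ρ : ℝ := min ε d / (8 * K) with hρ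
  have hmin : 0 < min ε d := lt_min hε hd0
  have hρ0 : 0 < ρ := by positivity
  have hρK : 8 * (K * ρ) = min ε d := by rw [hρ]; field_simp
  set η : ℝ := ρ / (8 * K) with hη
  have hη0 : 0 < η := by positivity
  have hηK : 8 * (K * η) = ρ := by rw [hη]; field_simp
  obtain ⟨N, hN, hpart⟩ := f.exists_uniform_partition hη0
  obtain ⟨Y, hY⟩ : ∃ Y : ℕ → ConeSeq C,
      ∀ i, SeparationQuotient.mk (Y i) = f.extend ((i : ℝ) / N) :=
    ⟨_, fun i => (SeparationQuotient.surjective_mk (f.extend ((i : ℝ) / N))).choose_spec⟩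
  set Z : ℕ → ConeSeq C := fun i => if i = 0 then z else if i = N then w else Y i with hZ
  have hZf : ∀ i, SeparationQuotient.mk (Z i) = f.extend ((i : ℝ) / N) := by
    intro i
    simp only [hZ]
    split_ifs with h₁ h₂
    · simp [h₁]
    · simp [h₂, hN.ne']
    · exact hY i
  have hstep : ∀ᶠ n in (C.ultra : Filter ℕ), ∀ i ∈ Iio N,
      dist ((Z i).1 n) ((Z (i + 1)).1 n) < η * C.scale n :=
    (eventually_all_finite (finite_Iio N)).2 fun i _ => ConeSeq.eventually_dist_lt (by
      rw [hZf, hZf]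
      exact hpart i)
  have hfar : ∀ᶠ n in (C.ultra : Filter ℕ), ∀ i ∈ Iic N,
      ε / 2 * C.scale n < dist ((Z i).1 n) (P.1 n) :=
    (eventually_all_finite (finite_Iic N)).2 fun i _ => ConeSeq.eventually_lt_dist (by
      rw [hZf]
      exact lt_of_lt_of_le (by linarith) (hfε (projIcc 0 1 zero_le_one _)))
  obtain ⟨n, h₁, h₂, h₃, h₄, h₅, h₆, h₇, h₈, h₉, h₁₀⟩ := (ha.and (hb.and (hab.and (hlow.and
    (hmI.and (hstep.and (hfar.and ((C.eventually_le_scale (4 * (L + 1) / ε)).and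
    ((C.eventually_le_scale (2 * K * (2 + c + L) / ρ)).and (C.eventually_le_scale
    ((N + 1 : ℕ) * (2 * (K * (c + L) + 1)) / ρ))))))))))).exists
  rw [div_le_iff₀ hε] at h₈
  rw [div_le_iff₀ hρ0] at h₉ h₁₀
  have hs := C.scale_pos n
  have hK1 : η ≤ K * η := le_mul_of_one_le_left hη0.le hK
  have hK2 : ρ ≤ K * ρ := le_mul_of_one_le_left hρ0.le hK
  have hKρε : K * ρ ≤ ε / 8 := by linarith [min_le_left ε d]
  have hρd : 2 * ρ ≤ d / (4 * K) := by
    rw [le_div_iff₀ (by positivity)]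
    linarith [min_le_right ε d]
  have hρs : 2 * (ρ * C.scale n) ≤ b n - a n :=
    le_trans (by rw [← mul_assoc]; exact mul_le_mul_of_nonneg_right hρd hs.le) h₄
  have hKρεs : K * (ρ * C.scale n) ≤ ε / 8 * C.scale n := by
    rw [← mul_assoc]
    exact mul_le_mul_of_nonneg_right hKρε hs.le
  obtain ⟨j, hj, hjN, -⟩ := hcon.exists_crossings (m := m n) (ρ := ρ * C.scale n)
    (H := ε / 8 * C.scale n) (η := η * C.scale n) (s := a n) (t := b n) (x := fun i => (Z i).1 n)
    (N := N) (n := N + 1) hγ hc hN h₁.1 h₂.1 h₅ (by simp [hZ, h₁.2]) (by simp [hZ, hN.ne', h₂.2])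
    (by simp only [hm]; linarith) (by simp only [hm]; linarith)
    (fun i hi => by
      have := h₇ i hi
      rw [hP, ConeSeq.ofDistLE_apply] at this
      linarith)
    (fun i hi => (h₆ i hi).le) (by positivity)
    (mul_lt_mul_of_pos_right (by linarith) hs)
    (by
      have : 8 * (K * (η * C.scale n)) = ρ * C.scale n := by rw [← hηK]; ring
      linarith)
    (by linarith)
  -- the crossings are numbered by distinct indices, of which there are too few
  have hjle : ∀ k ≤ N + 1, k ≤ j k := by
    intro k
    induction k with
    | zero => intro _; exact Nat.zero_le _
    | succ k ih => intro hk; exact (ih (by omega)).trans_lt (hj k (by omega))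
  have h₁₁ := hjle (N + 1) le_rfl
  have h₁₂ := hjN (N + 1) le_rfl
  omega

theorem IsCoarselyContracting.ultralimitsSeparated {K L c : ℝ} {I : Set ℝ} {γ : ℝ → X}
    (hγ : IsQuasiGeodesic K L I γ) (hcon : IsCoarselyContracting c (γ '' I)) (hc : 0 ≤ c) :
    UltralimitsSeparated (γ '' I) := by
  rintro C _ ⟨z, hz, rfl⟩ _ ⟨w, hw, rfl⟩ hne
  obtain ⟨a, ha⟩ := exists_param_of_eventually_mem hz
  obtain ⟨b, hb⟩ := exists_param_of_eventually_mem hw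
  rcases Ultrafilter.eventually_or.1 (Eventually.of_forall fun n => le_total (a n) (b n)) with h | h
  · exact hcon.separatedByCutpoint_of_le hγ hc hne ha hb h
  · exact (hcon.separatedByCutpoint_of_le hγ hc hne.symm hb ha h).symm

end

/-! ### Excursions and paths in the asymptotic cone -/

section

theorem JoinedIn.exists_first_mem {Y : Type*} [TopologicalSpace Y] {A F : Set Y} {u v : Y}
    (h : JoinedIn A u v) (hF : IsClosed F) (hv : v ∈ F) :
    ∃ z ∈ A, z ∈ F ∧ JoinedIn (Fᶜ ∪ {z}) u z := by
  obtain ⟨f, hf⟩ := h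
  have hcl : IsCompact {t : unitInterval | f t ∈ F} := (hF.preimage f.continuous).isCompact
  obtain ⟨t, ht, hmin⟩ := hcl.exists_isLeast ⟨1, by simpa using hv⟩
  refine ⟨f t, hf t, ht, JoinedIn.ofLine (f := fun s => f.extend (s * t))
    (f.continuous_extend.comp (by fun_prop)).continuousOn (by simp) (by simp) ?_⟩
  rintro _ ⟨s, hs, rfl⟩
  have hmem : s * (t : ℝ) ∈ Icc (0 : ℝ) 1 :=
    ⟨mul_nonneg hs.1 t.2.1, mul_le_one₀ hs.2 t.2.1 t.2.2⟩
  beta_reduce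
  rw [f.extend_apply hmem]
  by_cases hsF : f ⟨s * t, hmem⟩ ∈ F
  · right
    have h₁ : t ≤ ⟨s * t, hmem⟩ := hmin hsF
    have h₂ : (⟨s * t, hmem⟩ : unitInterval) ≤ t := mul_le_of_le_one_left t.2.1 hs.2
    rw [le_antisymm h₂ h₁]
    exact mem_singleton _
  · exact Or.inl hsF

variable {X : Type*} [MetricSpace X]

namespace ConeSeq

variable {C : ConeData X}

theorem mk_eq_of_forall_pos {y z : ConeSeq C} (A : ℝ)
    (h : ∀ ε > 0, ∃ B : ℝ, ∀ᶠ n in (C.ultra : Filter ℕ),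
      dist (y.1 n) (z.1 n) ≤ A * ε * C.scale n + B) :
    (SeparationQuotient.mk y : AsymptoticCone C) = SeparationQuotient.mk z := by
  have h' : ∀ ε > 0, dist (SeparationQuotient.mk y : AsymptoticCone C) (SeparationQuotient.mk z)
      ≤ A * ε := fun ε hε => dist_mk_le (h ε hε).choose_spec
  refine dist_le_zero.1 (ge_of_tendsto (x := 𝓝[>] (0 : ℝ)) (f := fun ε => A * ε) ?_
    (eventually_mem_nhdsWithin.mono h'))
  have : Tendsto (fun ε : ℝ => A * ε) (𝓝 0) (𝓝 (A * 0)) := (continuous_const_mul A).tendsto 0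
  rw [mul_zero] at this
  exact this.mono_left nhdsWithin_le_nhds

theorem mk_eq_of_eventuallyEq {y z : ConeSeq C}
    (h : ∀ᶠ n in (C.ultra : Filter ℕ), y.1 n = z.1 n) :
    (SeparationQuotient.mk y : AsymptoticCone C) = SeparationQuotient.mk z :=
  mk_eq_of_forall_pos 0 fun _ _ => ⟨0, h.mono fun n hn => by simp [hn]⟩

/-- Curves in `X` that are Lipschitz at the scale of the cone, up to a bounded error, converge to
a path in the cone. -/
theorem exists_joinedIn (z : ConeSeq C) {y : ℝ → ℕ → X} {Λ B : ℝ}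
    (h : ∀ θ ∈ Icc (0 : ℝ) 1, ∀ θ' ∈ Icc (0 : ℝ) 1, ∀ᶠ n in (C.ultra : Filter ℕ),
      dist (y θ n) (y θ' n) ≤ Λ * |θ - θ'| * C.scale n + B)
    (h0 : ∀ᶠ n in (C.ultra : Filter ℕ), z.1 n = y 0 n) :
    ∃ w : ConeSeq C, (∀ n, w.1 n = y 1 n) ∧
      JoinedIn {q : AsymptoticCone C | ∃ θ ∈ Icc (0 : ℝ) 1, ∃ v : ConeSeq C,
        (∀ n, v.1 n = y θ n) ∧ SeparationQuotient.mk v = q}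
        (SeparationQuotient.mk z) (SeparationQuotient.mk w) := by
  have hbd : ∀ θ : ℝ, ∃ A : ℝ, ∀ᶠ n in (C.ultra : Filter ℕ),
      dist (z.1 n) (y (projIcc 0 1 zero_le_one θ) n) ≤ A * C.scale n := by
    intro θ
    refine ⟨Λ * |0 - (projIcc 0 1 zero_le_one θ : ℝ)| + |B|, ?_⟩
    filter_upwards [h0, h 0 ⟨le_rfl, zero_le_one⟩ _ (projIcc 0 1 zero_le_one θ).2,
      C.eventually_le_scale 1] with n h₁ h₂ h₃
    rw [h₁, add_mul]
    refine h₂.trans (add_le_add_right ?_ _)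
    exact (le_abs_self B).trans (le_mul_of_one_le_right (abs_nonneg B) h₃)
  set Y : ℝ → ConeSeq C := fun θ => z.ofDistLE _ (hbd θ) with hY
  have hYθ : ∀ θ ∈ Icc (0 : ℝ) 1, ∀ n, (Y θ).1 n = y θ n := by
    intro θ hθ n
    rw [hY, ofDistLE_apply, projIcc_of_mem zero_le_one hθ]
  have hcont : ContinuousOn (fun θ => (SeparationQuotient.mk (Y θ) : AsymptoticCone C))
      (Icc 0 1) := by
    refine LipschitzOnWith.continuousOn (K := Λ.toNNReal) (LipschitzOnWith.of_dist_le_mul ?_)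
    intro θ hθ θ' hθ'
    refine (dist_mk_le (r := Λ * |θ - θ'|) (B := B) ?_).trans ?_
    · filter_upwards [h θ hθ θ' hθ'] with n hn
      rwa [hYθ θ hθ, hYθ θ' hθ']
    · rw [Real.dist_eq]
      exact mul_le_mul_of_nonneg_right (Real.le_coe_toNNReal Λ) (abs_nonneg _)
  refine ⟨Y 1, hYθ 1 ⟨zero_le_one, le_rfl⟩, JoinedIn.ofLine hcont (mk_eq_of_eventuallyEq ?_) rfl ?_⟩
  · filter_upwards [h0] with n hn
    rw [hYθ 0 ⟨le_rfl, zero_le_one⟩, hn]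
  · rintro _ ⟨θ, hθ, rfl⟩
    exact ⟨θ, hθ, Y θ, hYθ θ hθ, rfl⟩

end ConeSeq

variable {C : ConeData X}

theorem mem_ultralimit_of_infDist {S : Set X} (hS : S.Nonempty) {y : ConeSeq C}
    (h : ∀ ε > 0, ∀ᶠ n in (C.ultra : Filter ℕ), Metric.infDist (y.1 n) S ≤ ε * C.scale n) :
    SeparationQuotient.mk y ∈ ultralimit C S := by
  have hex : ∀ n, ∃ p ∈ S, dist (y.1 n) p < Metric.infDist (y.1 n) S + 1 := fun n =>
    (Metric.infDist_lt_iff hS).1 (lt_add_one _)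
  choose p hpS hp using hex
  set w := y.ofDistLE p ⟨2, by
    filter_upwards [h 1 one_pos, C.eventually_le_scale 1] with n h₁ h₂
    linarith [hp n]⟩ with hw
  refine ⟨w, Eventually.of_forall hpS, (ConeSeq.mk_eq_of_forall_pos 1 fun ε hε => ⟨1, ?_⟩).symm⟩
  filter_upwards [h ε hε] with n hn
  rw [hw, ConeSeq.ofDistLE_apply]
  linarith [hp n]

theorem isClosed_ultralimit (S : Set X) : IsClosed (ultralimit C S) := by
  refine isClosed_of_closure_subset fun q hq => ?_
  obtain ⟨y, rfl⟩ := SeparationQuotient.surjective_mk q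
  have happ : ∀ ε > 0, ∃ z : ConeSeq C, (∀ᶠ n in (C.ultra : Filter ℕ), z.1 n ∈ S) ∧
      ∀ᶠ n in (C.ultra : Filter ℕ), dist (y.1 n) (z.1 n) < ε * C.scale n := by
    intro ε hε
    obtain ⟨_, ⟨z, hz, rfl⟩, hd⟩ := Metric.mem_closure_iff.1 hq ε hε
    exact ⟨z, hz, ConeSeq.eventually_dist_lt hd⟩
  obtain ⟨z, hz, -⟩ := happ 1 one_pos
  obtain ⟨n, hn⟩ := hz.exists
  refine mem_ultralimit_of_infDist ⟨_, hn⟩ fun ε hε => ?_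
  obtain ⟨z, hz, hd⟩ := happ ε hε
  filter_upwards [hz, hd] with n h₁ h₂
  exact (Metric.infDist_le_dist_of_mem h₁).trans h₂.le

/-- The ultralimit of a quasi-geodesic is path connected. -/
theorem IsQuasiGeodesic.joinedIn_ultralimit {K L : ℝ} {I : Set ℝ} {γ : ℝ → X}
    (hγ : IsQuasiGeodesic K L I γ) {u v : AsymptoticCone C} (hu : u ∈ ultralimit C (γ '' I))
    (hv : v ∈ ultralimit C (γ '' I)) : JoinedIn (ultralimit C (γ '' I)) u v := by
  obtain ⟨z, hz, rfl⟩ := hu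
  obtain ⟨w, hw, rfl⟩ := hv
  obtain ⟨a, ha⟩ := exists_param_of_eventually_mem hz
  obtain ⟨b, hb⟩ := exists_param_of_eventually_mem hw
  have hK := hγ.one_le
  have hL := hγ.nonneg
  have hK0 : 0 < K := by linarith
  have hI : ∀ n, a n ∈ I → b n ∈ I → ∀ θ ∈ Icc (0 : ℝ) 1, a n + θ * (b n - a n) ∈ I := by
    intro n h₁ h₂ θ hθ
    have := hγ.interval.convex.add_smul_sub_mem h₁ h₂ hθ
    rwa [smul_eq_mul] at this
  set d := dist (SeparationQuotient.mk z : AsymptoticCone C) (SeparationQuotient.mk w) with hd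
  have hupp : ∀ᶠ n in (C.ultra : Filter ℕ), |a n - b n| ≤ K * (d + 2) * C.scale n := by
    filter_upwards [ha, hb, ConeSeq.eventually_dist_lt (y := z) (z := w) (r := d + 1)
      (by linarith), C.eventually_le_scale L] with n h₁ h₂ h₄ h₅
    have h₆ := hγ.lower _ h₁.1 _ h₂.1
    rw [h₁.2, h₂.2, sub_le_iff_le_add, div_le_iff₀ hK0] at h₆
    nlinarith
  obtain ⟨w', hw', hj⟩ := z.exists_joinedIn (y := fun θ n => γ (a n + θ * (b n - a n)))
    (Λ := K * (K * (d + 2))) (B := L) (fun θ hθ θ' hθ' => by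
      filter_upwards [ha, hb, hupp] with n h₁ h₂ h₃
      refine (hγ.upper _ (hI n h₁.1 h₂.1 θ hθ) _ (hI n h₁.1 h₂.1 θ' hθ')).trans ?_
      have e₁ : a n + θ * (b n - a n) - (a n + θ' * (b n - a n)) = (θ - θ') * (b n - a n) := by
        ring
      rw [e₁, abs_mul, abs_sub_comm (b n)]
      have h₄ := mul_le_mul_of_nonneg_left h₃ (mul_nonneg hK0.le (abs_nonneg (θ - θ')))
      linarith) (by
      filter_upwards [ha] with n h₁
      simp [h₁.2])
  have hww' : (SeparationQuotient.mk w' : AsymptoticCone C) = SeparationQuotient.mk w := by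
    refine ConeSeq.mk_eq_of_eventuallyEq ?_
    filter_upwards [hb] with n h₂
    rw [hw', one_mul, add_sub_cancel, h₂.2]
  rw [← hww']
  refine hj.mono ?_
  rintro _ ⟨θ, hθ, v, hv, rfl⟩
  refine ⟨v, ?_, rfl⟩
  filter_upwards [ha, hb] with n h₁ h₂
  rw [hv]
  exact mem_image_of_mem γ (hI n h₁.1 h₂.1 θ hθ)

/-- One side of an excursion. The quasi-geodesics `σ n` are followed from `t n` to `T n`, and then
geodesics to points `P n` of `S`; in the cone this path meets the ultralimit of `S` for a first
time, in a point represented by `y`. The last condition says that `y n` is much closer to a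
point `σ n (τ n)` of the quasi-geodesic than this is to `σ n (t n)`: it holds on the first part
with `y n = σ n (τ n)`, and on the second with `τ n = T n`. -/
theorem exists_first_mem_ultralimit (hX : IsCAT0 X) {K L : ℝ} {S : Set X} {J : ℕ → Set ℝ}
    {σ : ℕ → ℝ → X} (hσ : ∀ n, IsQuasiGeodesic K L (J n) (σ n)) {t T : ℕ → ℝ}
    (ht : ∀ n, t n ∈ J n) (hT : ∀ n, T n ∈ J n) (htT : ∀ n, |T n - t n| ≤ 4 * K * C.scale n)
    (hP : ∀ n, ∃ p ∈ S, dist (σ n (T n)) p ≤ |T n - t n| / (2 * K) + 1) {z : ConeSeq C}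
    (hz : ∀ n, z.1 n = σ n (t n)) :
    ∃ (y : ConeSeq C) (τ : ℕ → ℝ), SeparationQuotient.mk y ∈ ultralimit C S ∧
      JoinedIn ((ultralimit C S)ᶜ ∪ {SeparationQuotient.mk y}) (SeparationQuotient.mk z)
        (SeparationQuotient.mk y) ∧ (∀ n, τ n ∈ uIcc (t n) (T n)) ∧
      ∀ n, dist (y.1 n) (σ n (τ n)) ≤ |τ n - t n| / (2 * K) + 1 := by
  have hK := (hσ 0).one_le
  have hK0 : 0 < K := by linarith
  choose P hPS hPd using hP
  set A : Set (AsymptoticCone C) := {q | ∃ (y : ConeSeq C) (τ : ℕ → ℝ),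
    SeparationQuotient.mk y = q ∧ (∀ n, τ n ∈ uIcc (t n) (T n)) ∧
      ∀ n, dist (y.1 n) (σ n (τ n)) ≤ |τ n - t n| / (2 * K) + 1} with hA
  have hmem : ∀ n, ∀ θ ∈ Icc (0 : ℝ) 1, t n + θ * (T n - t n) ∈ uIcc (t n) (T n) := by
    intro n θ hθ
    have := (convex_uIcc (t n) (T n)).add_smul_sub_mem left_mem_uIcc right_mem_uIcc hθ
    rwa [smul_eq_mul] at this
  have hJ : ∀ n, uIcc (t n) (T n) ⊆ J n := fun n => (hσ n).interval.uIcc_subset (ht n) (hT n)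
  obtain ⟨w, hw, hj⟩ := z.exists_joinedIn (y := fun θ n => σ n (t n + θ * (T n - t n)))
    (Λ := K * (4 * K)) (B := L) (fun θ hθ θ' hθ' => Eventually.of_forall fun n => by
      refine ((hσ n).upper _ (hJ n (hmem n θ hθ)) _ (hJ n (hmem n θ' hθ'))).trans ?_
      have e₁ : t n + θ * (T n - t n) - (t n + θ' * (T n - t n)) = (θ - θ') * (T n - t n) := by
        ring
      rw [e₁, abs_mul]
      have h₄ := mul_le_mul_of_nonneg_left (htT n) (mul_nonneg hK0.le (abs_nonneg (θ - θ')))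
      linarith) (Eventually.of_forall fun n => by simp [hz])
  have hw' : ∀ n, w.1 n = σ n (T n) := fun n => by rw [hw, one_mul, add_sub_cancel]
  have hj₁ : JoinedIn A (SeparationQuotient.mk z) (SeparationQuotient.mk w) := by
    refine hj.mono ?_
    rintro _ ⟨θ, hθ, v, hv, rfl⟩
    refine ⟨v, fun n => t n + θ * (T n - t n), rfl, fun n => hmem n θ hθ, fun n => ?_⟩
    rw [hv, dist_self]
    positivity
  choose g hg using fun n => hX.exists_geodesic (σ n (T n)) (P n)
  have hgm : ∀ n, ∀ θ ∈ Icc (0 : ℝ) 1,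
      θ * dist (σ n (T n)) (P n) ∈ Icc 0 (dist (σ n (T n)) (P n)) := fun n θ hθ =>
    ⟨mul_nonneg hθ.1 dist_nonneg, mul_le_of_le_one_left dist_nonneg hθ.2⟩
  obtain ⟨f, hf, hj'⟩ := w.exists_joinedIn (y := fun θ n => g n (θ * dist (σ n (T n)) (P n)))
    (Λ := 2) (B := 1) (fun θ hθ θ' hθ' => Eventually.of_forall fun n => by
      rw [(hg n).isometry _ (hgm n θ hθ) _ (hgm n θ' hθ'), ← sub_mul, abs_mul,
        abs_of_nonneg (dist_nonneg (x := σ n (T n)))]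
      have h₁ : |T n - t n| / (2 * K) ≤ 2 * C.scale n := by
        rw [div_le_iff₀ (by positivity)]
        linarith [htT n]
      have h₂ : |θ - θ'| ≤ 1 := abs_le.2 ⟨by linarith [hθ.1, hθ'.2], by linarith [hθ.2, hθ'.1]⟩
      have h₃ := mul_le_mul_of_nonneg_left ((hPd n).trans (add_le_add_left h₁ 1))
        (abs_nonneg (θ - θ'))
      linarith) (Eventually.of_forall fun n => by simp [hw', (hg n).start])
  have hj₂ : JoinedIn A (SeparationQuotient.mk w) (SeparationQuotient.mk f) := by
    refine hj'.mono ?_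
    rintro _ ⟨θ, hθ, v, hv, rfl⟩
    refine ⟨v, T, rfl, fun n => right_mem_uIcc, fun n => ?_⟩
    rw [hv, dist_comm, (hg n).dist_start (hgm n θ hθ)]
    exact (hgm n θ hθ).2.trans (hPd n)
  have hfS : SeparationQuotient.mk f ∈ ultralimit C S := by
    refine ⟨f, Eventually.of_forall fun n => ?_, rfl⟩
    rw [hf, one_mul, (hg n).finish]
    exact hPS n
  obtain ⟨_, ⟨y, τ, rfl, hτ, hy⟩, hyS, hyj⟩ :=
    (hj₁.trans hj₂).exists_first_mem (isClosed_ultralimit S) hfS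
  exact ⟨y, τ, hyS, hyj, hτ, hy⟩

/-- Two points of a path connected set that are joined by a path meeting the set in these two
points only are not separated by a cutpoint. -/
theorem not_separatedByCutpoint_of_joinedIn {Y : Type*} [TopologicalSpace Y] {F : Set Y} {u v q : Y}
    (huv : JoinedIn F u v) (hu : JoinedIn (Fᶜ ∪ {u}) q u) (hv : JoinedIn (Fᶜ ∪ {v}) q v) :
    ¬ SeparatedByCutpoint u v := by
  rintro ⟨p, hpu, hpv, hp⟩
  by_cases hpF : p ∈ F
  · have hsub : ∀ w, p ≠ w → Fᶜ ∪ {w} ⊆ ({p}ᶜ : Set Y) := by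
      rintro w hpw x (hx | rfl) rfl
      exacts [hx hpF, hpw rfl]
    exact hp ((hu.mono (hsub u hpu)).symm.trans (hv.mono (hsub v hpv)))
  · exact hp (huv.mono fun x hx hxp => hpF (hxp ▸ hx))

theorem exists_forall_le_two_mul {s : Set ℝ} {f : ℝ → ℝ} (hbd : BddAbove (f '' s)) {t₀ : ℝ}
    (ht₀ : t₀ ∈ s) (hpos : 0 < f t₀) : ∃ t ∈ s, f t₀ ≤ f t ∧ ∀ t' ∈ s, f t' ≤ 2 * f t := by
  have hle : ∀ t' ∈ s, f t' ≤ sSup (f '' s) := fun t' ht' => le_csSup hbd (mem_image_of_mem f ht')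
  rcases le_or_gt (sSup (f '' s)) (2 * f t₀) with h | h
  · exact ⟨t₀, ht₀, le_rfl, fun t' ht' => (hle t' ht').trans h⟩
  · obtain ⟨_, ⟨t, ht, rfl⟩, hlt⟩ := exists_lt_of_lt_csSup (s := f '' s)
      ⟨_, mem_image_of_mem f ht₀⟩ (half_lt_self (a := sSup (f '' s)) (by linarith))
    exact ⟨t, ht, by linarith, fun t' ht' => (hle t' ht').trans (by linarith)⟩

/-- If quasi-geodesics with endpoints on `γ` make arbitrarily long excursions, they are rescaled by
the heights of the excursions. In the cone this yields an arc that meets the ultralimit of `γ` in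
its two endpoints only; a cutpoint between these would have to lie both on the ultralimit and on
the arc. -/
theorem UltralimitsSeparated.isMorse (hX : IsCAT0 X) {K L : ℝ} {I : Set ℝ} {γ : ℝ → X}
    (hγ : IsQuasiGeodesic K L I γ) (hsep : UltralimitsSeparated (γ '' I)) : IsMorse (γ '' I) := by
  set S := γ '' I with hS
  by_contra hM
  simp only [IsMorse, not_forall, not_exists, not_le] at hM
  obtain ⟨K', L', hM⟩ := hM
  have hex : ∀ n : ℕ, ∃ (a b : ℝ) (σ : ℝ → X) (t : ℝ), IsQuasiGeodesic K' L' (Icc a b) σ ∧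
      σ a ∈ S ∧ σ b ∈ S ∧ t ∈ Icc a b ∧ (n : ℝ) < Metric.infDist (σ t) S ∧
      ∀ t' ∈ Icc a b, Metric.infDist (σ t') S ≤ 2 * Metric.infDist (σ t) S := by
    intro n
    obtain ⟨a, b, σ, hab, hσ, ha, hb, t, ht, hn⟩ := hM n
    have hbd : BddAbove ((fun t => Metric.infDist (σ t) S) '' Icc a b) := by
      refine ⟨K' * (b - a) + L', ?_⟩
      rintro _ ⟨t', ht', rfl⟩
      refine (Metric.infDist_le_dist_of_mem ha).trans
        ((hσ.upper t' ht' a ⟨le_rfl, hab⟩).trans ?_)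
      rw [abs_of_nonneg (sub_nonneg.2 ht'.1)]
      nlinarith [hσ.one_le, ht'.2]
    obtain ⟨t', ht', h₁, h₂⟩ := exists_forall_le_two_mul hbd ht ((Nat.cast_nonneg n).trans_lt hn)
    exact ⟨a, b, σ, t', hσ, ha, hb, ht', hn.trans_le h₁, h₂⟩
  choose a b σ t hσ ha hb ht hn hmax using hex
  have hK := (hσ 0).one_le
  have hL := (hσ 0).nonneg
  have hK0 : 0 < K' := by linarith
  let C : ConeData X :=
    { ultra := hyperfilter ℕ
      nonprincipal := fun n => notMem_hyperfilter_of_finite (finite_singleton n)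
      base := fun n => σ n (t n)
      scale := fun n => Metric.infDist (σ n (t n)) S
      scale_pos := fun n => (Nat.cast_nonneg n).trans_lt (hn n)
      scale_tendsto := (tendsto_atTop_mono (fun n => (hn n).le)
        tendsto_natCast_atTop_atTop).mono_left Nat.hyperfilter_le_atTop }
  have hscale : ∀ n, C.scale n = Metric.infDist (σ n (t n)) S := fun n => rfl
  let z : ConeSeq C := Subtype.mk (fun n => σ n (t n))
    ⟨0, Eventually.of_forall fun n => by simp [C]⟩
  have hz : ∀ n, z.1 n = σ n (t n) := fun n => rfl
  have hzS : (SeparationQuotient.mk z : AsymptoticCone C) ∉ ultralimit C S := by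
    rintro ⟨w, hw, hwz⟩
    obtain ⟨n, h₁, h₂⟩ := (hw.and (ConeSeq.eventually_dist_lt (y := z) (z := w) (r := 1)
      (by rw [hwz, dist_self]; exact one_pos))).exists
    have := Metric.infDist_le_dist_of_mem (x := z.1 n) h₁
    rw [one_mul, hscale] at h₂
    exact absurd h₂ (not_lt.2 this)
  -- `4 * K'` rescaled units are long enough to beat the final geodesics, of length at most `2`
  have hside : ∀ n T, T ∈ Icc (a n) (b n) → (σ n T ∈ S ∨ |T - t n| = 4 * K' * C.scale n) →
      ∃ p ∈ S, dist (σ n T) p ≤ |T - t n| / (2 * K') + 1 := by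
    rintro n T hT (h | h)
    · refine ⟨_, h, ?_⟩
      rw [dist_self]
      positivity
    · obtain ⟨p, hp, hlt⟩ := (Metric.infDist_lt_iff ⟨_, ha n⟩).1
        (lt_add_one (Metric.infDist (σ n T) S))
      refine ⟨p, hp, hlt.le.trans ?_⟩
      have e₁ : |T - t n| / (2 * K') = 2 * C.scale n := by
        rw [h]
        field_simp
        ring
      rw [e₁, hscale]
      linarith [hmax n T hT]
  have hs : ∀ n, 0 < 4 * K' * C.scale n := fun n => by
    have := C.scale_pos n
    positivity
  obtain ⟨y₁, τ₁, hy₁S, hy₁j, hτ₁, hy₁⟩ := exists_first_mem_ultralimit (C := C) (S := S) hX hσ ht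
    (T := fun n => min (b n) (t n + 4 * K' * C.scale n))
    (fun n => ⟨le_min ((ht n).1.trans (ht n).2) (by linarith [(ht n).1, hs n]), min_le_left _ _⟩)
    (fun n => by
      have h₁ : t n ≤ min (b n) (t n + 4 * K' * C.scale n) :=
        le_min (ht n).2 (by linarith [hs n])
      rw [abs_of_nonneg (sub_nonneg.2 h₁)]
      linarith [min_le_right (b n) (t n + 4 * K' * C.scale n)])
    (fun n => by
      refine hside n _ ⟨le_min ((ht n).1.trans (ht n).2) (by linarith [(ht n).1, hs n]),
        min_le_left _ _⟩ ?_
      rcases min_choice (b n) (t n + 4 * K' * C.scale n) with h | h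
      · left; rw [h]; exact hb n
      · right; rw [h, add_sub_cancel_left, abs_of_pos (hs n)]) hz
  obtain ⟨y₂, τ₂, hy₂S, hy₂j, hτ₂, hy₂⟩ := exists_first_mem_ultralimit (C := C) (S := S) hX hσ ht
    (T := fun n => max (a n) (t n - 4 * K' * C.scale n))
    (fun n => ⟨le_max_left _ _, max_le ((ht n).1.trans (ht n).2) (by linarith [(ht n).2, hs n])⟩)
    (fun n => by
      have h₁ : max (a n) (t n - 4 * K' * C.scale n) ≤ t n :=
        max_le (ht n).1 (by linarith [hs n])
      rw [abs_sub_comm, abs_of_nonneg (sub_nonneg.2 h₁)]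
      linarith [le_max_right (a n) (t n - 4 * K' * C.scale n)])
    (fun n => by
      refine hside n _ ⟨le_max_left _ _, max_le ((ht n).1.trans (ht n).2)
        (by linarith [(ht n).2, hs n])⟩ ?_
      rcases max_choice (a n) (t n - 4 * K' * C.scale n) with h | h
      · left; rw [h]; exact ha n
      · right; rw [h, abs_sub_comm, sub_sub_cancel, abs_of_pos (hs n)]) hz
  have hτ₁' : ∀ n, τ₁ n ∈ Icc (t n) (b n) := by
    intro n
    have h₁ : t n ≤ min (b n) (t n + 4 * K' * C.scale n) := le_min (ht n).2 (by linarith [hs n])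
    have h₂ := hτ₁ n
    rw [uIcc_of_le h₁] at h₂
    exact ⟨h₂.1, h₂.2.trans (min_le_left _ _)⟩
  have hτ₂' : ∀ n, τ₂ n ∈ Icc (a n) (t n) := by
    intro n
    have h₁ : max (a n) (t n - 4 * K' * C.scale n) ≤ t n := max_le (ht n).1 (by linarith [hs n])
    have h₂ := hτ₂ n
    rw [uIcc_of_ge h₁] at h₂
    exact ⟨(le_max_left _ _).trans h₂.1, h₂.2⟩
  have hne : (SeparationQuotient.mk y₁ : AsymptoticCone C) ≠ SeparationQuotient.mk y₂ := by
    intro heq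
    refine hzS ?_
    have hyz : (SeparationQuotient.mk y₁ : AsymptoticCone C) = SeparationQuotient.mk z := by
      refine ConeSeq.mk_eq_of_forall_pos (1 + 2 * K' ^ 2) fun ε hε =>
        ⟨(2 + L') + 1 + 2 * K' ^ 2 * (2 + L') + L', ?_⟩
      filter_upwards [ConeSeq.eventually_dist_lt (y := y₁) (z := y₂) (r := ε)
        (by rw [heq, dist_self]; exact hε)] with n h₁
      have m₁ : τ₁ n ∈ Icc (a n) (b n) := ⟨(ht n).1.trans (hτ₁' n).1, (hτ₁' n).2⟩
      have m₂ : τ₂ n ∈ Icc (a n) (b n) := ⟨(hτ₂' n).1, (hτ₂' n).2.trans (ht n).2⟩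
      have h₂ := hy₁ n
      have h₃ := hy₂ n
      have h₄ := (hσ n).lower _ m₁ _ m₂
      have h₅ := (hσ n).upper _ m₁ _ (ht n)
      rw [abs_of_nonneg (by linarith [(hτ₁' n).1])] at h₂ h₅
      rw [abs_sub_comm, abs_of_nonneg (by linarith [(hτ₂' n).2])] at h₃
      rw [abs_of_nonneg (by linarith [(hτ₁' n).1, (hτ₂' n).2]), sub_le_iff_le_add] at h₄
      rw [hz]
      set A := (τ₁ n - τ₂ n) / (2 * K') with hA
      have hAK : τ₁ n - τ₂ n = 2 * K' * A := by rw [hA]; field_simp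
      have e₁ : (τ₁ n - τ₂ n) / K' = 2 * A := by rw [hA]; field_simp
      have e₂ : (τ₁ n - t n) / (2 * K') + (t n - τ₂ n) / (2 * K') = A := by
        rw [hA, ← add_div]
        congr 1
        ring
      have e₃ : (τ₁ n - t n) / (2 * K') ≤ A :=
        div_le_div_of_nonneg_right (by linarith [(hτ₂' n).2]) (by positivity)
      rw [e₁] at h₄
      have h₆ := dist_triangle4 (σ n (τ₁ n)) (y₁.1 n) (y₂.1 n) (σ n (τ₂ n))
      rw [dist_comm (σ n (τ₁ n)) (y₁.1 n)] at h₆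
      have h₇ := dist_triangle (y₁.1 n) (σ n (τ₁ n)) (σ n (t n))
      have h₈ : A ≤ ε * C.scale n + 2 + L' := by linarith
      have h₉ : K' * (τ₁ n - t n) ≤ 2 * K' ^ 2 * (ε * C.scale n + 2 + L') := by
        have h := mul_le_mul_of_nonneg_left h₈ (by positivity : 0 ≤ 2 * K' ^ 2)
        have h' := mul_le_mul_of_nonneg_left
          (by linarith [(hτ₂' n).2] : τ₁ n - t n ≤ 2 * K' * A) hK0.le
        linarith
      linarith
    rw [← hyz]
    exact hy₁S
  exact not_separatedByCutpoint_of_joinedIn (hγ.joinedIn_ultralimit hy₁S hy₂S) hy₁j hy₂j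
    (hsep C _ hy₁S _ hy₂S hne)

end

/-! ### The equivalences and the divergence -/

theorem theorem3p4 {X : Type*} [MetricSpace X] (hX : IsCAT0 X)
    (K L : ℝ) (I : Set ℝ) (γ : ℝ → X) (hγ : IsQuasiGeodesic K L I γ) :
    ((∀ x : X, (nearestPoints (γ '' I) x).Nonempty) →
      List.TFAE
        [∃ b c : ℝ, 0 < b ∧ b ≤ 1 ∧ 0 < c ∧ IsContracting b c (γ '' I),
         ∃ c : ℝ, 0 < c ∧ IsContracting 1 c (γ '' I),
         IsMorse (γ '' I),
         UltralimitsSeparated (γ '' I)]) ∧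
    (IsMorse (γ '' I) ↔ UltralimitsSeparated (γ '' I)) ∧
    (I = Set.univ →
      ((∀ x : X, (nearestPoints (γ '' I) x).Nonempty) ∧
          ((∃ b c : ℝ, 0 < b ∧ b ≤ 1 ∧ 0 < c ∧ IsContracting b c (γ '' I)) ∨
           (∃ c : ℝ, 0 < c ∧ IsContracting 1 c (γ '' I)))) ∨
        IsMorse (γ '' I) ∨ UltralimitsSeparated (γ '' I) →
      HasAtLeastQuadraticDivergence γ) := by
  have morse_iff : IsMorse (γ '' I) ↔ UltralimitsSeparated (γ '' I) := by
    refine ⟨fun h => ?_, fun h => h.isMorse hX hγ⟩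
    obtain ⟨c, hc, hcon⟩ := h.exists_isCoarselyContracting hX
    exact hcon.ultralimitsSeparated hγ hc.le
  refine ⟨fun hnear => ?_, morse_iff, ?_⟩
  · tfae_have 1 → 3 := by
      rintro ⟨b, c, hb, -, hc, h⟩
      exact h.isMorse hb hc hnear
    tfae_have 3 → 2 := by
      intro h
      obtain ⟨c, hc, hcon⟩ := h.exists_isCoarselyContracting hX
      exact ⟨c + 1, by linarith, hcon.isContracting⟩
    tfae_have 2 → 1 := by
      rintro ⟨c, hc, h⟩
      exact ⟨1, c, one_pos, le_rfl, hc, h⟩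
    tfae_have 3 ↔ 4 := morse_iff
    tfae_finish
  · rintro rfl h
    have hM : IsMorse (γ '' univ) := by
      rcases h with ⟨hnear, ⟨b, c, hb, -, hc, h⟩ | ⟨c, hc, h⟩⟩ | h | h
      · exact h.isMorse hb hc hnear
      · exact h.isMorse one_pos hc hnear
      · exact h
      · exact morse_iff.2 h
    obtain ⟨c, hc, hcon⟩ := hM.exists_isCoarselyContracting hX
    exact hcon.hasAtLeastQuadraticDivergence hγ hc.le
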